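/- Let $\mathbb K$ be an algebraically closed field of characteristic zero, let $n,d\ge 4$, and let $$I=(x_0^d,\dots,x_n^d)+x_0^{d-1}(x_0,\dots,x_n)\subset \mathbb K[x_0,\dots,x_n],\qquad A=\mathbb K[x_0,\dots,x_n]/I .$$ Let polynomials act on polynomials as differential operators, $x_i$ acting as $\partial/\partial x_i$, and let $I^{-1}_d$ be the space of forms $F$ of degree $d$ with $\alpha(F)=0$ for all $\alpha\in I$. For a basis $F_1,\dots,F_N$ of $I^{-1}_d$ let $X_d\subset\mathbb P^{N-1}$ be the Zariski closure of the image of the rational map $\mathbb P^n\dashrightarrow\mathbb P^{N-1}$, $P\mapsto (F_1(P):\dots:F_N(P))$. The $s$-th osculating space $T^s_xX_d$ of $X_d$ at a smooth point $x$ is the linear subspace of $\mathbb P^{N-1}$ spanned by the values at $0$ of all partial derivatives of order $\le s$ of a local parametrization $\varphi$ of $X_d$ by power series in $\dim X_d$ variables with $\varphi(0)=x$. A variety $X$ of dimension $n$ satisfies exactly $\delta$ Laplace equations of order $s$ if $\dim T^s_xX=\binom{n+s}{s}-1-\delta$ at a generic smooth point $x\in X$. Then, for every choice of the basis, $X_d$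 has dimension $n$ and satisfies exactly one Laplace equation of order $d-1$, that is, $\dim T^{d-1}_xX_d=\binom{n+d-1}{d-1}-2$ for generic $x\in X_d$. Moreover, the kernel of the multiplication map $$\times(x_0+\dots+x_n)\colon A_{d-1}\to A_d$$ is one-dimensional, spanned by the class of $x_0^{d-1}$, which is nonzero. -/

import Mathlib

/-!
Let `D` be a form of degree `d - 1` and `F` a form of degree `d`. By Euler's formula the value
`D(F)(P)` is, up to a factorial, the scalar `(L_P * D)(F)`, where `L_P = ∑ P_i x_i`. The vectors
`(D(F_j)(P))_j` span the osculating space of order `d - 1` at the point `(F_j(P))_j`, so by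
Macaulay duality the linear relations among them are the forms `D` of degree `d - 1` with
`L_P * D ∈ I`, and every such relation is a Laplace equation.

For the Togliatti ideal, `L_P * D ∈ I` means that `L_P * D = x₀ ^ (d - 1) * Q + ∑ μ_i x_i ^ d` with
`i ≥ 1` in the sum. If no `P_i` vanishes, restricting to `x₀ = L_P = 0` shows that all `μ_i` are
zero, and then `D` is a multiple of `x₀ ^ (d - 1)` by unique factorization. For `P = (1, …, 1)` this
also computes the kernel of the multiplication map.

The image has dimension `n`, and its points coming from the torus are smooth, because
`x₁ ^ (d - 2) * x₂ * x_i` lies in the inverse system for every `i`: the coordinates of `P` are, up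
to a common nonzero factor, linear forms in the `F_j(P)`.
-/


noncomputable section

namespace Osculating

open MvPolynomial
open scoped LinearAlgebra.Projectivization

variable {K : Type*} [Field K]

/-! ### Derivatives, apolarity and inverse systems -/

/-- The iterated operator `D₀ ^ a₀ ∘ D₁ ^ a₁ ∘ ⋯` attached to a multi-index `a`.  With `D` the
partial derivatives this is the mixed partial derivative of multi-order `a`. -/
def iterDeriv {M : Type*} [AddCommGroup M] [Module K M] {m : ℕ}
    (D : Fin m → Module.End K M) (a : Fin m →₀ ℕ) : Module.End K M :=
  (List.ofFn fun i => D i ^ a i).prod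

/-- The polynomial `α` acting on polynomials as a differential operator: the variable `X i` of `α`
acts as `∂ / ∂ x i`. -/
def apolarAction {m : ℕ} (α : MvPolynomial (Fin m) K) :
    Module.End K (MvPolynomial (Fin m) K) :=
  ∑ a ∈ α.support, α.coeff a •
    iterDeriv (fun i => (pderiv i : Derivation K _ _).toLinearMap) a

/-- Macaulay's inverse system of `I`: all `f` with `α(f) = 0` for every `α ∈ I`. -/
def inverseSystem {m : ℕ} (I : Ideal (MvPolynomial (Fin m) K)) :
    Submodule K (MvPolynomial (Fin m) K) :=
  ⨅ α ∈ I, LinearMap.ker (apolarAction α)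

/-- The degree `k` piece of the inverse system of `I`. -/
def inverseSystemDeg {m : ℕ} (I : Ideal (MvPolynomial (Fin m) K)) (k : ℕ) :
    Submodule K (MvPolynomial (Fin m) K) :=
  inverseSystem I ⊓ homogeneousSubmodule (Fin m) K k

/-! ### Graded quotient algebras and multiplication maps -/

/-- The degree `k` piece `A_k` of `A = K[x] / I`. -/
def gradedPiece {m : ℕ} (I : Ideal (MvPolynomial (Fin m) K)) (k : ℕ) :
    Submodule K (MvPolynomial (Fin m) K ⧸ I) :=
  (homogeneousSubmodule (Fin m) K k).map (Ideal.Quotient.mkₐ K I).toLinearMap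

theorem mk_mem_gradedPiece {m : ℕ} (I : Ideal (MvPolynomial (Fin m) K)) {k : ℕ}
    {f : MvPolynomial (Fin m) K} (hf : f.IsHomogeneous k) :
    Ideal.Quotient.mk I f ∈ gradedPiece I k :=
  ⟨f, hf, rfl⟩

theorem mul_mem_gradedPiece {m : ℕ} (I : Ideal (MvPolynomial (Fin m) K))
    {L : MvPolynomial (Fin m) K} {i j k : ℕ} (hL : L.IsHomogeneous j) (h : i + j = k) :
    ∀ x ∈ gradedPiece I i,
      LinearMap.mulLeft K (Ideal.Quotient.mk I L) x ∈ gradedPiece I k := by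
  rintro _ ⟨f, hf, rfl⟩
  have hf' : f.IsHomogeneous i := hf
  subst h
  exact ⟨L * f, by simpa [add_comm] using hL.mul hf', by simp⟩

/-- The multiplication map `×L : A_i → A_{i+j}` by a form `L` of degree `j`. -/
def mulMap {m : ℕ} (I : Ideal (MvPolynomial (Fin m) K))
    {L : MvPolynomial (Fin m) K} {i j k : ℕ} (hL : L.IsHomogeneous j) (h : i + j = k) :
    gradedPiece I i →ₗ[K] gradedPiece I k :=
  (LinearMap.mulLeft K (Ideal.Quotient.mk I L)).restrict (mul_mem_gradedPiece I hL h)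

/-- The linear form `x₀ + ⋯ + x_{m-1}`. -/
def sumForm (K : Type*) [Field K] (m : ℕ) : MvPolynomial (Fin m) K := ∑ i, X i

theorem sumForm_isHomogeneous (K : Type*) [Field K] (m : ℕ) :
    (sumForm K m).IsHomogeneous 1 :=
  IsHomogeneous.sum _ _ _ fun i _ => isHomogeneous_X K i

/-- The ideal `(x₀^d, …, x_n^d) + x₀^{d-1} (x₀, …, x_n)` of `K[x₀, …, x_n]`. -/
def togliattiIdeal (K : Type*) [Field K] (n d : ℕ) : Ideal (MvPolynomial (Fin (n + 1)) K) :=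
  Ideal.span (Set.range fun i => X i ^ d) ⊔
    Ideal.span {X 0 ^ (d - 1)} * Ideal.span (Set.range fun i => X i)

/-! ### Zariski topology of projective space -/

section Projective

variable {ι : Type*}

/-- The form `G` vanishes at the point `x` of projective space (only used for homogeneous `G`, so
the choice of the representative is irrelevant). -/
def VanishesAt (G : MvPolynomial ι K) (x : ℙ K (ι → K)) : Prop := eval x.rep G = 0

/-- Zariski closed subsets of projective space. -/
def IsZariskiClosed (Z : Set (ℙ K (ι → K))) : Prop :=
  ∃ S : Set (MvPolynomial ι K), (∀ G ∈ S, ∃ k, G.IsHomogeneous k) ∧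
    Z = {x | ∀ G ∈ S, VanishesAt G x}

/-- The Zariski closure of a subset of projective space. -/
def zariskiClosure (T : Set (ℙ K (ι → K))) : Set (ℙ K (ι → K)) :=
  ⋂₀ {Z | IsZariskiClosed Z ∧ T ⊆ Z}

/-- The homogeneous polynomials that vanish on the set `T`. -/
def vanishingForms (T : Set (ℙ K (ι → K))) : Set (MvPolynomial ι K) :=
  {G | (∃ k, G.IsHomogeneous k) ∧ ∀ x ∈ T, VanishesAt G x}

/-- The image of the rational map `P ↦ (F_j(P))_j`, which is defined at those `P` at which some
`F_j` does not vanish. -/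
def rationalImage {m : ℕ} (F : ι → MvPolynomial (Fin m) K) : Set (ℙ K (ι → K)) :=
  {y | ∃ (P : Fin m → K) (h : (fun j => eval P (F j)) ≠ 0),
    y = Projectivization.mk K (fun j => eval P (F j)) h}

/-- The closure of the image of the rational map given by the forms `F_j`. -/
def imageVariety {m : ℕ} (F : ι → MvPolynomial (Fin m) K) : Set (ℙ K (ι → K)) :=
  zariskiClosure (rationalImage F)

variable [Fintype ι]

/-- The vector space over the embedded (projective) Zariski tangent space of `T` at the point
represented by `v`: the vectors killed by the differentials at `v` of all forms vanishing on `T`.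
It contains `v`, and its dimension is one more than that of the Zariski tangent space. -/
def tangentCone (T : Set (ℙ K (ι → K))) (v : ι → K) : Submodule K (ι → K) :=
  ⨅ G ∈ vanishingForms T,
    LinearMap.ker (∑ i, eval v (pderiv i G) • (LinearMap.proj i : (ι → K) →ₗ[K] K))

/-! ### Local parametrizations, osculating spaces, Laplace equations -/

/-- The span of the values at `0` of all partial derivatives of order `≤ s` (order `0` included) of
the tuple of power series `φ`.  This is the vector space over the `s`-th osculating space at
`φ(0)` of the variety parametrized by `φ`. -/
def jetSpan {m : ℕ} (φ : ι → MvPowerSeries (Fin m) K) (s : ℕ) : Submodule K (ι → K) :=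
  Submodule.span K {w | ∃ a : Fin m →₀ ℕ, a.degree ≤ s ∧
    w = fun j => MvPowerSeries.constantCoeff
      (iterDeriv (fun i => (MvPowerSeries.pderiv K i).toLinearMap) a (φ j))}

/-- `φ` is a formal local parametrization, by `m` parameters, of `T` at the smooth point `x`, in
homogeneous coordinates: `φ(0)` represents `x`, all equations of `T` hold identically on `φ`, and
the `m + 1` vectors `φ(0), ∂₁φ(0), …, ∂ₘφ(0)` are a basis of the (vector space over the) Zariski
tangent space of `T` at `x`.  Equivalently, `φ` induces an isomorphism of the completed local ring
of `T` at `x` with `K⟦t₁, …, tₘ⟧`; such a `φ` exists if and only if `x` is a smooth point of `T`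
at which `T` has dimension `m`. -/
structure IsLocalParametrization {m : ℕ} (T : Set (ℙ K (ι → K))) (x : ℙ K (ι → K))
    (φ : ι → MvPowerSeries (Fin m) K) : Prop where
  base_mem : x ∈ T
  base : ∃ h : (fun j => MvPowerSeries.constantCoeff (φ j)) ≠ 0,
    Projectivization.mk K (fun j => MvPowerSeries.constantCoeff (φ j)) h = x
  equations : ∀ G ∈ vanishingForms T, aeval φ G = 0
  tangent : jetSpan φ 1 = tangentCone T (fun j => MvPowerSeries.constantCoeff (φ j))
  finrank_tangent : Module.finrank K (jetSpan φ 1) = m + 1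

/-- The projective dimension of the `s`-th osculating space given by the parametrization `φ`. -/
def osculatingDim {m : ℕ} (φ : ι → MvPowerSeries (Fin m) K) (s : ℕ) : ℤ :=
  (Module.finrank K (jetSpan φ s) : ℤ) - 1

/-- The `n`-dimensional projective variety `T` satisfies (exactly) `δ` Laplace equations of order
`s`: the points of a dense Zariski open subset of `T` are smooth points at which `T` has dimension
`n`, and the `s`-th osculating space there has dimension `binom(n+s, s) - 1 - δ`. -/
def SatisfiesLaplaceEquations (T : Set (ℙ K (ι → K))) (n s δ : ℕ) : Prop :=
  T.Nonempty ∧ ∃ Z : Set (ℙ K (ι → K)), IsZariskiClosed Z ∧ T ⊆ zariskiClosure (T \ Z) ∧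
    ∀ x ∈ T \ Z,
      (∃ φ : ι → MvPowerSeries (Fin n) K, IsLocalParametrization T x φ) ∧
      ∀ φ : ι → MvPowerSeries (Fin n) K, IsLocalParametrization T x φ →
        osculatingDim φ s = ((n + s).choose s : ℤ) - 1 - δ

end Projective

end Osculating

end


noncomputable section

namespace Osculating

open MvPolynomial
open scoped LinearAlgebra.Projectivization

attribute [local instance] MvPolynomial.gradedAlgebra

variable {K : Type*} [Field K] {m : ℕ}

/-! ### Iterated derivatives -/

theorem multiIndex_induction {p : (Fin m →₀ ℕ) → Prop} (zero : p 0)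
    (add_single : ∀ b j, p b → p (b + Finsupp.single j 1)) (a : Fin m →₀ ℕ) : p a := by
  rw [← Finsupp.toMultiset_toFinsupp a]
  induction Finsupp.toMultiset a using Multiset.induction with
  | empty => simpa using zero
  | cons j s ih =>
    rw [← Multiset.singleton_add, add_comm, map_add, Multiset.toFinsupp_singleton]
    exact add_single _ j ih

theorem prod_ofFn_mul {M : Type*} [Monoid M] (f g : Fin m → M)
    (h : ∀ i j, Commute (f i) (g j)) :
    (List.ofFn fun i => f i * g i).prod = (List.ofFn f).prod * (List.ofFn g).prod := by
  induction m with
  | zero => simp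
  | succ m ih =>
    have hc : Commute (g 0) (List.ofFn fun i : Fin m => f i.succ).prod :=
      Commute.list_prod_right _ _ fun x hx => by
        obtain ⟨i, rfl⟩ := List.mem_ofFn.1 hx
        exact (h _ _).symm
    simp only [List.ofFn_succ, List.prod_cons, ih _ _ fun i j => h i.succ j.succ]
    rw [mul_assoc, mul_assoc, ← mul_assoc (g 0), hc.eq, mul_assoc]

section IterDeriv

variable {M : Type*} [AddCommGroup M] [Module K M] {D : Fin m → Module.End K M}

theorem iterDeriv_zero : iterDeriv D 0 = 1 := by simp [iterDeriv]

theorem iterDeriv_single_one (j : Fin m) : iterDeriv D (Finsupp.single j 1) = D j := by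
  rw [iterDeriv, List.ofFn_eq_map, List.prod_map_eq_pow_single j]
  · simp [List.count_eq_one_of_mem (List.nodup_finRange m) (List.mem_finRange j)]
  · intro i hi _
    simp [hi]

theorem iterDeriv_add (hD : ∀ i j, Commute (D i) (D j)) (a b : Fin m →₀ ℕ) :
    iterDeriv D (a + b) = iterDeriv D a * iterDeriv D b := by
  simp only [iterDeriv, Finsupp.add_apply, pow_add]
  exact prod_ofFn_mul _ _ fun i j => (hD i j).pow_pow _ _

end IterDeriv

/-- The factorial `∏ i, (a i)!` of a multi-index, by which coefficients and derivatives at the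
origin differ. -/
def multiFactorial (a : Fin m →₀ ℕ) : ℕ := ∏ i, (a i).factorial

theorem multiFactorial_ne_zero (a : Fin m →₀ ℕ) : multiFactorial a ≠ 0 :=
  Finset.prod_ne_zero_iff.2 fun _ _ => Nat.factorial_ne_zero _

theorem multiFactorial_zero : multiFactorial (0 : Fin m →₀ ℕ) = 1 := by
  simp [multiFactorial]

theorem multiFactorial_add_single_one (a : Fin m →₀ ℕ) (j : Fin m) :
    multiFactorial (a + Finsupp.single j 1) = multiFactorial a * (a j + 1) := by
  have hrest : ∏ i ∈ Finset.univ.erase j, ((a + Finsupp.single j 1 : Fin m →₀ ℕ) i).factorial =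
      ∏ i ∈ Finset.univ.erase j, (a i).factorial :=
    Finset.prod_congr rfl fun i hi => by simp [(Finset.ne_of_mem_erase hi).symm]
  rw [multiFactorial, multiFactorial, ← Finset.mul_prod_erase _ _ (Finset.mem_univ j), hrest,
    ← Finset.mul_prod_erase _ _ (Finset.mem_univ j), Finsupp.add_apply, Finsupp.single_eq_same,
    Nat.factorial_succ]
  ring

section Coefficients

variable {M : Type*} [AddCommGroup M] [Module K M] {D : Fin m → Module.End K M}
  {co : (Fin m →₀ ℕ) → M →ₗ[K] K}

theorem commute_of_coeff (hco : ∀ f g, (∀ c, co c f = co c g) → f = g)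
    (hD : ∀ i c f, co c (D i f) = co (c + Finsupp.single i 1) f * (c i + 1)) (i j : Fin m) :
    Commute (D i) (D j) := by
  refine LinearMap.ext fun f => hco _ _ fun c => ?_
  rw [Module.End.mul_apply, Module.End.mul_apply, hD, hD, hD, hD, add_right_comm]
  rcases eq_or_ne i j with rfl | h
  · rfl
  · simp [h, h.symm, mul_right_comm]

theorem multiFactorial_mul_coeff_iterDeriv (hcomm : ∀ i j, Commute (D i) (D j))
    (hD : ∀ i c f, co c (D i f) = co (c + Finsupp.single i 1) f * (c i + 1))
    (a c : Fin m →₀ ℕ) (f : M) :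
    multiFactorial c * co c (iterDeriv D a f) = multiFactorial (a + c) * co (a + c) f := by
  induction a using multiIndex_induction generalizing f with
  | zero => rw [iterDeriv_zero, zero_add, Module.End.one_apply]
  | add_single b j ih =>
    rw [iterDeriv_add hcomm, iterDeriv_single_one, Module.End.mul_apply, ih, hD,
      add_right_comm b _ c, multiFactorial_add_single_one]
    push_cast
    ring

end Coefficients

/-- The partial derivative `∂ / ∂ x i` of polynomials, as a linear operator. -/
abbrev polyPartial (i : Fin m) : Module.End K (MvPolynomial (Fin m) K) :=
  (pderiv i : Derivation K _ _).toLinearMap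

/-- The partial derivative `∂ / ∂ t i` of power series, as a linear operator. -/
abbrev seriesPartial (i : Fin m) : Module.End K (MvPowerSeries (Fin m) K) :=
  (MvPowerSeries.pderiv K i).toLinearMap

theorem commute_polyPartial (i j : Fin m) : Commute (polyPartial (K := K) i) (polyPartial j) :=
  commute_of_coeff (co := fun c => lcoeff K c) (fun _ _ => MvPolynomial.ext _ _)
    (fun _ c f => coeff_pderiv f c) i j

theorem commute_seriesPartial (i j : Fin m) :
    Commute (seriesPartial (K := K) i) (seriesPartial j) :=
  commute_of_coeff (co := fun c => MvPowerSeries.coeff c) (fun _ _ => MvPowerSeries.ext)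
    (fun _ c f => MvPowerSeries.coeff_pderiv f c) i j

theorem iterDeriv_polyPartial_add_apply (a b : Fin m →₀ ℕ) (f : MvPolynomial (Fin m) K) :
    iterDeriv polyPartial (a + b) f = iterDeriv polyPartial a (iterDeriv polyPartial b f) := by
  rw [iterDeriv_add commute_polyPartial, Module.End.mul_apply]

theorem constantCoeff_iterDeriv_polyPartial (a : Fin m →₀ ℕ) (f : MvPolynomial (Fin m) K) :
    constantCoeff (iterDeriv polyPartial a f) = multiFactorial a * coeff a f := by
  simpa [multiFactorial_zero, constantCoeff_eq] using
    multiFactorial_mul_coeff_iterDeriv (co := fun c => lcoeff K c) commute_polyPartial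
      (fun _ c f => coeff_pderiv f c) a 0 f

theorem constantCoeff_iterDeriv_seriesPartial (a : Fin m →₀ ℕ) (f : MvPowerSeries (Fin m) K) :
    MvPowerSeries.constantCoeff (iterDeriv seriesPartial a f) =
      multiFactorial a * MvPowerSeries.coeff a f := by
  simpa [multiFactorial_zero] using
    multiFactorial_mul_coeff_iterDeriv (co := fun c => MvPowerSeries.coeff c)
      commute_seriesPartial (fun _ c f => MvPowerSeries.coeff_pderiv f c) a 0 f

theorem isHomogeneous_iterDeriv {f : MvPolynomial (Fin m) K} {k : ℕ} (hf : f.IsHomogeneous k)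
    (a : Fin m →₀ ℕ) : (iterDeriv polyPartial a f).IsHomogeneous (k - a.degree) := by
  induction a using multiIndex_induction generalizing f k with
  | zero => simpa [iterDeriv_zero] using hf
  | add_single b j ih =>
    rw [iterDeriv_polyPartial_add_apply, iterDeriv_single_one, map_add, Finsupp.degree_single,
      add_comm, Nat.sub_add_eq]
    exact ih hf.pderiv

/-! ### Apolarity -/

/-- The action of polynomials as differential operators, as a homomorphism of algebras.  It agrees
with `apolarAction`, see `apolarHom_apply`. -/
def apolarHom : MvPolynomial (Fin m) K →ₐ[K] Module.End K (MvPolynomial (Fin m) K) :=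
  AddMonoidAlgebra.lift K _ _
    { toFun := fun a => iterDeriv polyPartial a.toAdd
      map_one' := iterDeriv_zero
      map_mul' := fun a b => iterDeriv_add commute_polyPartial a.toAdd b.toAdd }

theorem apolarHom_apply (α : MvPolynomial (Fin m) K) : apolarHom α = apolarAction α := by
  rw [apolarHom, AddMonoidAlgebra.lift_apply]
  rfl

theorem apolarHom_monomial (a : Fin m →₀ ℕ) (c : K) :
    apolarHom (monomial a c) = c • iterDeriv polyPartial a := by
  rw [apolarHom]; exact AddMonoidAlgebra.lift_single _ _ _

theorem apolarHom_X (i : Fin m) : apolarHom (X i : MvPolynomial (Fin m) K) = polyPartial i := by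
  rw [X, apolarHom_monomial, one_smul, iterDeriv_single_one]

theorem constantCoeff_apolarHom (α F : MvPolynomial (Fin m) K) :
    constantCoeff (apolarHom α F) =
      ∑ a ∈ α.support, coeff a α * (multiFactorial a * coeff a F) := by
  simp [apolarHom_apply, apolarAction, constantCoeff_iterDeriv_polyPartial]

theorem mem_inverseSystemDeg {I : Ideal (MvPolynomial (Fin m) K)} {k : ℕ}
    {F : MvPolynomial (Fin m) K} :
    F ∈ inverseSystemDeg I k ↔ (∀ α ∈ I, apolarHom α F = 0) ∧ F.IsHomogeneous k := by
  simp only [inverseSystemDeg, inverseSystem, Submodule.mem_inf, Submodule.mem_iInf,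
    LinearMap.mem_ker, apolarHom_apply, mem_homogeneousSubmodule]

theorem isHomogeneous_apolarHom {α F : MvPolynomial (Fin m) K} {j k : ℕ}
    (hα : α.IsHomogeneous j) (hF : F.IsHomogeneous k) :
    (apolarHom α F).IsHomogeneous (k - j) := by
  rw [apolarHom_apply, apolarAction, LinearMap.sum_apply]
  refine IsHomogeneous.sum _ _ _ fun a ha => ?_
  have hdeg : a.degree = j := by
    by_contra h
    exact mem_support_iff.1 ha (hα.coeff_eq_zero h)
  rw [LinearMap.smul_apply, ← hdeg, smul_eq_C_mul]
  exact (isHomogeneous_iterDeriv hF a).C_mul _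

theorem eq_zero_of_constantCoeff_iterDeriv [CharZero K] {F : MvPolynomial (Fin m) K}
    (h : ∀ a, constantCoeff (iterDeriv polyPartial a F) = 0) : F = 0 := by
  ext a
  have := h a
  rw [constantCoeff_iterDeriv_polyPartial] at this
  exact (mul_eq_zero.1 this).resolve_left (Nat.cast_ne_zero.2 (multiFactorial_ne_zero a))

theorem apolarHom_eq_zero_of_mem [CharZero K] {I : Ideal (MvPolynomial (Fin m) K)}
    {F : MvPolynomial (Fin m) K} (h : ∀ β ∈ I, constantCoeff (apolarHom β F) = 0)
    {α : MvPolynomial (Fin m) K} (hα : α ∈ I) : apolarHom α F = 0 := by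
  refine eq_zero_of_constantCoeff_iterDeriv fun a => ?_
  rw [← one_smul K (iterDeriv polyPartial a), ← apolarHom_monomial, ← Module.End.mul_apply,
    ← map_mul]
  exact h _ (I.mul_mem_left _ hα)

theorem mem_univ_finsuppAntidiag {k : ℕ} {a : Fin m →₀ ℕ} :
    a ∈ Finset.univ.finsuppAntidiag k ↔ a.degree = k := by
  simp [Finsupp.degree_eq_sum]

/-- The form of degree `k` that represents, under the apolarity pairing, the restriction of the
linear functional `f` to the forms of degree `k`. -/
def apolarDual (f : MvPolynomial (Fin m) K →ₗ[K] K) (k : ℕ) : MvPolynomial (Fin m) K :=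
  ∑ a ∈ Finset.univ.finsuppAntidiag k, monomial a (f (monomial a 1) / multiFactorial a)

theorem isHomogeneous_apolarDual (f : MvPolynomial (Fin m) K →ₗ[K] K) (k : ℕ) :
    (apolarDual f k).IsHomogeneous k :=
  IsHomogeneous.sum _ _ _ fun _ ha => isHomogeneous_monomial _ (mem_univ_finsuppAntidiag.1 ha)

theorem coeff_apolarDual (f : MvPolynomial (Fin m) K →ₗ[K] K) (k : ℕ) (a : Fin m →₀ ℕ) :
    coeff a (apolarDual f k) =
      if a.degree = k then f (monomial a 1) / multiFactorial a else 0 := by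
  simp only [apolarDual, coeff_sum, coeff_monomial, Finset.sum_ite_eq', mem_univ_finsuppAntidiag]

theorem constantCoeff_apolarHom_apolarDual [CharZero K] (f : MvPolynomial (Fin m) K →ₗ[K] K)
    (k : ℕ) (α : MvPolynomial (Fin m) K) :
    constantCoeff (apolarHom α (apolarDual f k)) = f (homogeneousComponent k α) := by
  rw [constantCoeff_apolarHom, homogeneousComponent_apply, map_sum, Finset.sum_filter]
  refine Finset.sum_congr rfl fun a _ => ?_
  rw [coeff_apolarDual]
  split_ifs
  · rw [mul_div_cancel₀ _ (Nat.cast_ne_zero.2 (multiFactorial_ne_zero a)), ← smul_eq_mul,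
      ← map_smul, smul_monomial, smul_eq_mul, mul_one]
  · rw [mul_zero, mul_zero]

theorem apolarDual_mem_inverseSystemDeg [CharZero K] {I : Ideal (MvPolynomial (Fin m) K)}
    (hI : I.IsHomogeneous (homogeneousSubmodule (Fin m) K)) {f : MvPolynomial (Fin m) K →ₗ[K] K}
    (hf : I.restrictScalars K ≤ LinearMap.ker f) (k : ℕ) :
    apolarDual f k ∈ inverseSystemDeg I k := by
  refine mem_inverseSystemDeg.2
    ⟨fun α hα => apolarHom_eq_zero_of_mem (fun β hβ => ?_) hα, isHomogeneous_apolarDual f k⟩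
  rw [constantCoeff_apolarHom_apolarDual]
  exact hf (homogeneousComponent_mem_of_mem hI hβ k)

/-- Macaulay duality in degree `k`. -/
theorem mem_iff_forall_apolarHom_eq_zero [CharZero K] {I : Ideal (MvPolynomial (Fin m) K)}
    (hI : I.IsHomogeneous (homogeneousSubmodule (Fin m) K)) {α : MvPolynomial (Fin m) K} {k : ℕ}
    (hα : α.IsHomogeneous k) :
    α ∈ I ↔ ∀ F ∈ inverseSystemDeg I k, apolarHom α F = 0 := by
  refine ⟨fun h F hF => (mem_inverseSystemDeg.1 hF).1 α h, fun h => ?_⟩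
  by_contra hαI
  obtain ⟨f, hfα, hfI⟩ :=
    Submodule.exists_le_ker_of_notMem (p := I.restrictScalars K) (v := α) hαI
  refine hfα ?_
  have hcomp : homogeneousComponent k α = α := by rw [homogeneousComponent_of_mem hα, if_pos rfl]
  rw [← hcomp, ← constantCoeff_apolarHom_apolarDual,
    h _ (apolarDual_mem_inverseSystemDeg hI hfI k), map_zero]

/-! ### Relations among derivatives -/

/-- The linear form `∑ P i • X i` dual to the point `P`. -/
def linearForm (P : Fin m → K) : MvPolynomial (Fin m) K := ∑ i, C (P i) * X i

theorem isHomogeneous_linearForm (P : Fin m → K) : (linearForm P).IsHomogeneous 1 :=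
  IsHomogeneous.sum _ _ _ fun i _ => (isHomogeneous_X K i).C_mul _

theorem eval_apolarHom_linearForm {F : MvPolynomial (Fin m) K} {k : ℕ} (hF : F.IsHomogeneous k)
    (P : Fin m → K) : eval P (apolarHom (linearForm P) F) = k * eval P F := by
  have heuler := congrArg (eval P) hF.sum_X_mul_pderiv
  simpa [linearForm, apolarHom_X, ← smul_eq_C_mul] using heuler

theorem apolarHom_linearForm_eq_zero_iff {F : MvPolynomial (Fin m) K} (hF : F.IsHomogeneous 1)
    (P : Fin m → K) : apolarHom (linearForm P) F = 0 ↔ eval P F = 0 := by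
  have hconst : (apolarHom (linearForm P) F).totalDegree = 0 :=
    (totalDegree_zero_iff_isHomogeneous _).2
      (isHomogeneous_apolarHom (isHomogeneous_linearForm P) hF)
  have heval := eval_apolarHom_linearForm hF P
  rw [totalDegree_eq_zero_iff_eq_C.1 hconst] at heval ⊢
  rw [Nat.cast_one, one_mul, eval_C] at heval
  rw [← heval, C_eq_zero]

/-- The forms `D` of degree `k` such that `L * D ∈ I`: the degree `k` piece of the colon ideal
`I : L`. -/
def colonDeg (I : Ideal (MvPolynomial (Fin m) K)) (L : MvPolynomial (Fin m) K) (k : ℕ) :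
    Submodule K (MvPolynomial (Fin m) K) :=
  homogeneousSubmodule (Fin m) K k ⊓ (I.restrictScalars K).comap (LinearMap.mulLeft K L)

theorem mem_colonDeg {I : Ideal (MvPolynomial (Fin m) K)} {L D : MvPolynomial (Fin m) K} {k : ℕ} :
    D ∈ colonDeg I L k ↔ D.IsHomogeneous k ∧ L * D ∈ I := Iff.rfl

theorem ker_mulMap_eq_span_singleton {I : Ideal (MvPolynomial (Fin m) K)}
    {L f : MvPolynomial (Fin m) K} {i j k : ℕ} (hL : L.IsHomogeneous j) (h : i + j = k)
    (hf : f.IsHomogeneous i) (hcolon : colonDeg I L i = Submodule.span K {f}) :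
    LinearMap.ker (mulMap I hL h) =
      Submodule.span K {⟨Ideal.Quotient.mk I f, mk_mem_gradedPiece I hf⟩} := by
  have hmem {g : MvPolynomial (Fin m) K} (hg : g.IsHomogeneous i) :
      mulMap I hL h ⟨_, mk_mem_gradedPiece I hg⟩ = 0 ↔ g ∈ Submodule.span K {f} := by
    rw [← hcolon, mem_colonDeg, and_iff_right hg, Subtype.ext_iff, ← Ideal.Quotient.eq_zero_iff_mem,
      map_mul]
    rfl
  apply le_antisymm
  · rintro ⟨_, g, hg, rfl⟩ hker
    obtain ⟨c, rfl⟩ := Submodule.mem_span_singleton.1 ((hmem hg).1 hker)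
    exact Submodule.mem_span_singleton.2
      ⟨c, Subtype.ext (map_smul (Ideal.Quotient.mkₐ K I) c f).symm⟩
  · rw [Submodule.span_singleton_le_iff_mem, LinearMap.mem_ker, hmem hf]
    exact Submodule.mem_span_singleton_self f

theorem homogeneousSubmodule_eq_span_monomial (k : ℕ) :
    homogeneousSubmodule (Fin m) K k =
      Submodule.span K ((fun a => monomial a 1) '' {a | a.degree = k}) := by
  rw [homogeneousSubmodule_eq_finsupp_supported, AddMonoidAlgebra.supported_eq_span_single]
  rfl

theorem finrank_homogeneousSubmodule (k : ℕ) :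
    Module.finrank K (homogeneousSubmodule (Fin m) K k) = (m + k - 1).choose k := by
  have hcard := Module.finrank_eq_nat_card_basis
    (basisRestrictSupport K {a : Fin m →₀ ℕ | a.degree = k})
  have hset : {a : Fin m →₀ ℕ | a.degree = k} =
      (Finset.univ.finsuppAntidiag k : Finset (Fin m →₀ ℕ)) := by
    ext a
    exact mem_univ_finsuppAntidiag.symm
  rw [homogeneousSubmodule_eq_finsupp_supported]
  refine hcard.trans ?_
  rw [hset, Nat.card_eq_card_toFinset]
  simp [Finset.card_finsuppAntidiag_nat_eq_choose]

section DerivVector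

variable {ι : Type*}

/-- The values at `P` of the derivatives of multi-order `a` of the members of the family `F`. -/
def derivVector (F : ι → MvPolynomial (Fin m) K) (P : Fin m → K) (a : Fin m →₀ ℕ) : ι → K :=
  fun j => eval P (iterDeriv polyPartial a (F j))

/-- The values at `P` of the members of the family `F`, differentiated by a polynomial. -/
def derivMap (F : ι → MvPolynomial (Fin m) K) (P : Fin m → K) :
    MvPolynomial (Fin m) K →ₗ[K] ι → K :=
  LinearMap.pi fun j => (aeval P).toLinearMap ∘ₗ LinearMap.applyₗ (F j) ∘ₗ apolarHom.toLinearMap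

theorem derivMap_apply (F : ι → MvPolynomial (Fin m) K) (P : Fin m → K)
    (D : MvPolynomial (Fin m) K) (j : ι) : derivMap F P D j = eval P (apolarHom D (F j)) := rfl

theorem map_derivMap_homogeneousSubmodule (F : ι → MvPolynomial (Fin m) K) (P : Fin m → K)
    (k : ℕ) : (homogeneousSubmodule (Fin m) K k).map (derivMap F P) =
      Submodule.span K (derivVector F P '' {a | a.degree = k}) := by
  rw [homogeneousSubmodule_eq_span_monomial, Submodule.map_span, Set.image_image]
  congr! 2 with a
  funext j
  rw [derivMap_apply, apolarHom_monomial, one_smul, derivVector]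

theorem derivMap_basis_eq_zero_iff [CharZero K] {I : Ideal (MvPolynomial (Fin m) K)}
    (hI : I.IsHomogeneous (homogeneousSubmodule (Fin m) K)) {k : ℕ}
    (F : Module.Basis ι K (inverseSystemDeg I (k + 1))) (P : Fin m → K)
    {D : MvPolynomial (Fin m) K} (hD : D.IsHomogeneous k) :
    derivMap (fun j => (F j : MvPolynomial (Fin m) K)) P D = 0 ↔
      D ∈ colonDeg I (linearForm P) k := by
  have hLD : (linearForm P * D).IsHomogeneous (k + 1) :=
    add_comm 1 k ▸ (isHomogeneous_linearForm P).mul hD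
  have hDF (j : ι) : (apolarHom D (F j)).IsHomogeneous 1 := by
    simpa using isHomogeneous_apolarHom hD (mem_inverseSystemDeg.1 (F j).2).2
  have hbasis : (∀ j, apolarHom (linearForm P * D) (F j) = 0) ↔
      ∀ G ∈ inverseSystemDeg I (k + 1), apolarHom (linearForm P * D) G = 0 := by
    refine ⟨fun h G hG => ?_, fun h j => h _ (F j).2⟩
    exact LinearMap.congr_fun
      (F.ext h : apolarHom (linearForm P * D) ∘ₗ Submodule.subtype _ = 0) ⟨G, hG⟩
  rw [mem_colonDeg, and_iff_right hD, mem_iff_forall_apolarHom_eq_zero hI hLD, ← hbasis,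
    _root_.funext_iff]
  refine forall_congr' fun j => ?_
  rw [derivMap_apply, Pi.zero_apply, ← apolarHom_linearForm_eq_zero_iff (hDF j), map_mul,
    Module.End.mul_apply]

theorem finrank_span_derivVector_add_finrank_colonDeg [CharZero K]
    {I : Ideal (MvPolynomial (Fin m) K)}
    (hI : I.IsHomogeneous (homogeneousSubmodule (Fin m) K)) {k : ℕ}
    (F : Module.Basis ι K (inverseSystemDeg I (k + 1))) (P : Fin m → K) :
    Module.finrank K (Submodule.span K
        (derivVector (fun j => (F j : MvPolynomial (Fin m) K)) P '' {a | a.degree = k})) +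
      Module.finrank K (colonDeg I (linearForm P) k) = (m + k - 1).choose k := by
  set f := derivMap (fun j => (F j : MvPolynomial (Fin m) K)) P with hf
  have hfinite : Module.Finite K (homogeneousSubmodule (Fin m) K k) :=
    Module.Finite.iff_fg.2 (homogeneousSubmodule_fg (Fin m) K k)
  have hker : LinearMap.ker (f.domRestrict (homogeneousSubmodule (Fin m) K k)) =
      (colonDeg I (linearForm P) k).comap (Submodule.subtype _) := by
    ext D
    exact derivMap_basis_eq_zero_iff hI F P D.2
  have hle : colonDeg I (linearForm P) k ≤ homogeneousSubmodule (Fin m) K k := inf_le_left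
  rw [← map_derivMap_homogeneousSubmodule, ← hf, ← LinearMap.range_domRestrict,
    ← (Submodule.comapSubtypeEquivOfLe hle).finrank_eq, ← finrank_homogeneousSubmodule (K := K),
    ← LinearMap.finrank_range_add_finrank_ker
      (f.domRestrict (homogeneousSubmodule (Fin m) K k)), hker]

end DerivVector

/-! ### Orders of power series along a local parametrization -/

section Order

variable {f g : MvPowerSeries (Fin m) K} {k : ℕ}

theorem natCast_le_order_iff : k ≤ f.order ↔ ∀ a, a.degree < k → MvPowerSeries.coeff a f = 0 :=
  ⟨fun h _ ha => MvPowerSeries.coeff_of_lt_order ((Nat.cast_lt.2 ha).trans_le h),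
    MvPowerSeries.nat_le_order⟩

theorem natCast_le_order_iff_iterDeriv [CharZero K] : k ≤ f.order ↔
    ∀ a, a.degree < k → MvPowerSeries.constantCoeff (iterDeriv seriesPartial a f) = 0 := by
  simp only [natCast_le_order_iff, constantCoeff_iterDeriv_seriesPartial, mul_eq_zero,
    Nat.cast_eq_zero, multiFactorial_ne_zero, false_or]

theorem natCast_succ_le_order_iff [CharZero K] : (k + 1 : ℕ) ≤ f.order ↔
    MvPowerSeries.constantCoeff f = 0 ∧ ∀ i, k ≤ (MvPowerSeries.pderiv K i f).order := by
  simp only [natCast_le_order_iff, MvPowerSeries.coeff_pderiv]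
  constructor
  · refine fun h => ⟨h 0 (by simp), fun i a ha => ?_⟩
    rw [h _ (by simpa using ha), zero_mul]
  · rintro ⟨h0, h⟩ a ha
    cases a using multiIndex_induction with
    | zero => exact h0
    | add_single b j =>
      have hb : b.degree < k := by simpa using ha
      exact (mul_eq_zero.1 (h j b hb)).resolve_right (Nat.cast_add_one_ne_zero _)

theorem natCast_le_order_sum {α : Type*} {s : Finset α} {f : α → MvPowerSeries (Fin m) K}
    (h : ∀ i ∈ s, k ≤ (f i).order) : k ≤ (∑ i ∈ s, f i).order :=
  Finset.sum_induction f (fun p => k ≤ p.order)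
    (fun _ _ hp hq => (le_min hp hq).trans MvPowerSeries.min_order_le_add)
    (by simp) h

theorem order_isUnit_mul (hg : IsUnit g) : (g * f).order = f.order := by
  have hg0 : g.order = 0 := by
    by_contra h
    exact (MvPowerSeries.isUnit_iff_constantCoeff.1 hg).ne_zero
      (MvPowerSeries.order_ne_zero_iff_constCoeff_eq_zero.1 h)
  rw [MvPowerSeries.order_mul, hg0, zero_add]

theorem order_nsmul [CharZero K] {e : ℕ} (he : e ≠ 0) : (e • f).order = f.order := by
  rw [nsmul_eq_mul]
  refine order_isUnit_mul (MvPowerSeries.isUnit_iff_constantCoeff.2 ?_)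
  simpa using he

theorem forall_natCast_le_order_mulVec_iff {l : ℕ}
    {A : Matrix (Fin l) (Fin l) (MvPowerSeries (Fin m) K)} (hA : IsUnit A.det)
    {v : Fin l → MvPowerSeries (Fin m) K} :
    (∀ i, k ≤ (A.mulVec v i).order) ↔ ∀ i, k ≤ (v i).order := by
  have mulVec_le (B : Matrix (Fin l) (Fin l) (MvPowerSeries (Fin m) K))
      {w : Fin l → MvPowerSeries (Fin m) K} (hw : ∀ j, k ≤ (w j).order) (i : Fin l) :
      k ≤ (B.mulVec w i).order := by
    rw [Matrix.mulVec, dotProduct]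
    exact natCast_le_order_sum fun j _ =>
      (hw j).trans (le_add_self.trans MvPowerSeries.le_order_mul)
  refine ⟨fun h => ?_, mulVec_le A⟩
  have hinv : A⁻¹.mulVec (A.mulVec v) = v := by
    rw [Matrix.mulVec_mulVec, Matrix.nonsing_inv_mul _ hA, Matrix.one_mulVec]
  exact hinv ▸ mulVec_le A⁻¹ h

end Order

section Chain

variable {ι : Type*}

theorem constantCoeff_aeval (p : ι → MvPowerSeries (Fin m) K) (G : MvPolynomial ι K) :
    MvPowerSeries.constantCoeff (aeval p G) =
      eval (fun j => MvPowerSeries.constantCoeff (p j)) G := by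
  induction G using MvPolynomial.induction_on with
  | C a => simp [MvPowerSeries.algebraMap_apply]
  | add f g hf hg => simp [hf, hg]
  | mul_X f i hf => simp [hf]

theorem derivation_aeval [Fintype ι] {A : Type*} [CommRing A] [Algebra K A]
    (δ : Derivation K A A) (p : ι → A) (G : MvPolynomial ι K) :
    δ (aeval p G) = ∑ j, aeval p (pderiv j G) * δ (p j) := by
  classical
  induction G using MvPolynomial.induction_on with
  | C a => simp
  | add f g hf hg => simp [hf, hg, add_mul, Finset.sum_add_distrib]
  | mul_X f i hf =>
    simp only [map_mul, aeval_X, Derivation.leibniz, hf, smul_eq_mul, map_add, pderiv_X, add_mul,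
      Finset.sum_add_distrib, Finset.mul_sum, mul_assoc]
    congr 1
    rw [Finset.sum_eq_single i (fun j _ hj => by simp [Pi.single_eq_of_ne' hj]) (by simp)]
    simp

theorem sum_aeval_pderiv_mul [Fintype ι] {A : Type*} [CommRing A] [Algebra K A] {k : ℕ}
    {G : MvPolynomial ι K} (hG : G.IsHomogeneous k) (p : ι → A) :
    ∑ j, aeval p (pderiv j G) * p j = k • aeval p G := by
  rw [← map_nsmul, ← hG.sum_X_mul_pderiv, map_sum]
  simp only [map_mul, aeval_X, mul_comm]

/-- The tuple of power series `p`, followed by its first partial derivatives. -/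
def jetMatrix (p : ι → MvPowerSeries (Fin m) K) :
    Matrix (Fin (m + 1)) ι (MvPowerSeries (Fin m) K) :=
  Matrix.of (Fin.cons p fun i j => MvPowerSeries.pderiv K i (p j))

/-- The values at `0` of the tuple of power series `p` and of its first partial derivatives. -/
def frame (p : ι → MvPowerSeries (Fin m) K) : Fin (m + 1) → ι → K :=
  fun i j => MvPowerSeries.constantCoeff (jetMatrix p i j)

theorem jetMatrix_mulVec_gradient [Fintype ι] {e : ℕ} {G : MvPolynomial ι K}
    (hG : G.IsHomogeneous e) (p : ι → MvPowerSeries (Fin m) K) :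
    (jetMatrix p).mulVec (fun j => aeval p (pderiv j G)) =
      Fin.cons (e • aeval p G) fun i => MvPowerSeries.pderiv K i (aeval p G) := by
  funext i
  refine Fin.cases ?_ (fun i => ?_) i
  · simp [← sum_aeval_pderiv_mul hG p, jetMatrix, Matrix.mulVec, dotProduct, mul_comm]
  · simp [derivation_aeval, jetMatrix, Matrix.mulVec, dotProduct, mul_comm]

theorem isUnit_det_jetMatrix {p : Fin (m + 1) → MvPowerSeries (Fin m) K}
    (hp : LinearIndependent K (frame p)) : IsUnit (jetMatrix p).det := by
  rw [MvPowerSeries.isUnit_iff_constantCoeff, RingHom.map_det]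
  exact (Matrix.isUnit_iff_isUnit_det _).1 (Matrix.linearIndependent_rows_iff_isUnit.1 hp)

variable [CharZero K] {p : Fin (m + 1) → MvPowerSeries (Fin m) K} {e k : ℕ}
  {G : MvPolynomial (Fin (m + 1)) K}

theorem natCast_succ_le_order_aeval_iff (hp : LinearIndependent K (frame p))
    (hG : G.IsHomogeneous e) (he : e ≠ 0) (hk : k ≠ 0) :
    (k + 1 : ℕ) ≤ (aeval p G).order ↔ ∀ j, k ≤ (aeval p (pderiv j G)).order := by
  rw [← forall_natCast_le_order_mulVec_iff (isUnit_det_jetMatrix hp), jetMatrix_mulVec_gradient hG,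
    Fin.forall_fin_succ, natCast_succ_le_order_iff]
  simp only [Fin.cons_zero, Fin.cons_succ, order_nsmul he]
  refine and_congr_left fun hpartial => ⟨fun h0 => ?_, fun h => ?_⟩
  · exact (Nat.cast_le.2 k.le_succ).trans (natCast_succ_le_order_iff.2 ⟨h0, hpartial⟩)
  · exact MvPowerSeries.one_le_order_iff_constCoeff_eq_zero.1
      ((Nat.one_le_cast.2 (Nat.one_le_iff_ne_zero.2 hk)).trans h)

theorem natCast_succ_le_order_aeval_iff_iterDeriv (hp : LinearIndependent K (frame p))
    (hG : G.IsHomogeneous e) (hk : k < e) :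
    (k + 1 : ℕ) ≤ (aeval p G).order ↔ ∀ b : Fin (m + 1) →₀ ℕ, b.degree = k →
      eval (fun j => MvPowerSeries.constantCoeff (p j)) (iterDeriv polyPartial b G) = 0 := by
  induction k generalizing G e with
  | zero =>
    rw [zero_add, Nat.cast_one, MvPowerSeries.one_le_order_iff_constCoeff_eq_zero,
      constantCoeff_aeval]
    simp only [Finsupp.degree_eq_zero_iff, forall_eq, iterDeriv_zero, Module.End.one_apply]
  | succ k ih =>
    rw [natCast_succ_le_order_aeval_iff hp hG (by omega) k.succ_ne_zero]
    simp only [ih hG.pderiv (show k < e - 1 by omega)]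
    refine ⟨fun h b hb => ?_, fun h j b hb => ?_⟩
    · cases b using multiIndex_induction with
      | zero => simp at hb
      | add_single c j =>
        rw [iterDeriv_polyPartial_add_apply, iterDeriv_single_one]
        exact h j c (by simpa using hb)
    · have := h (b + Finsupp.single j 1) (by simp [hb])
      rwa [iterDeriv_polyPartial_add_apply, iterDeriv_single_one] at this

end Chain

/-! ### Differentials and osculating spaces -/

section Differential

variable {ι : Type*} [Fintype ι]

/-- The differential at the point `P` of the polynomial function `G`. -/
def differential (P : ι → K) (G : MvPolynomial ι K) : (ι → K) →ₗ[K] K :=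
  ∑ i, eval P (pderiv i G) • LinearMap.proj i

theorem differential_apply (P v : ι → K) (G : MvPolynomial ι K) :
    differential P G v = ∑ i, eval P (pderiv i G) * v i := by
  simp [differential]

theorem differential_sub (P : ι → K) (G H : MvPolynomial ι K) :
    differential P (G - H) = differential P G - differential P H := by
  ext v
  simp [differential_apply, sub_mul]

theorem differential_mul (P : ι → K) (G H : MvPolynomial ι K) :
    differential P (G * H) = eval P H • differential P G + eval P G • differential P H := by
  simp only [differential, Finset.smul_sum, ← Finset.sum_add_distrib]
  refine Finset.sum_congr rfl fun i _ => ?_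
  rw [pderiv_mul, map_add, map_mul, map_mul]
  module

theorem differential_X (P : ι → K) (i : ι) : differential P (X i) = LinearMap.proj i := by
  classical
  simp [differential, pderiv_X, Pi.single_apply, apply_ite (eval P)]

theorem differential_self {d : ℕ} {G : MvPolynomial ι K} (hG : G.IsHomogeneous d) (P : ι → K) :
    differential P G P = d * eval P G := by
  simpa [differential_apply, aeval_eq_eval] using sum_aeval_pderiv_mul hG P

theorem mem_tangentCone {T : Set (ℙ K (ι → K))} {v w : ι → K} :
    w ∈ tangentCone T v ↔ ∀ G ∈ vanishingForms T, differential v G w = 0 := by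
  simp only [tangentCone, Submodule.mem_iInf, LinearMap.mem_ker, differential]

theorem differential_frame {k : ℕ} {G : MvPolynomial ι K} (hG : G.IsHomogeneous k)
    (p : ι → MvPowerSeries (Fin m) K) (i : Fin (m + 1)) :
    differential (fun j => MvPowerSeries.constantCoeff (p j)) G (frame p i) =
      MvPowerSeries.constantCoeff
        ((Fin.cons (k • aeval p G) fun i => MvPowerSeries.pderiv K i (aeval p G) :
          Fin (m + 1) → MvPowerSeries (Fin m) K) i) := by
  rw [← jetMatrix_mulVec_gradient hG p, Matrix.mulVec, dotProduct, map_sum, differential_apply]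
  simp only [map_mul, constantCoeff_aeval, frame, mul_comm]

end Differential

theorem eval_aeval {σ τ : Type*} (P : σ → K) (F : τ → MvPolynomial σ K)
    (G : MvPolynomial τ K) :
    eval P (aeval F G) = eval (fun j => eval P (F j)) G := by
  rw [← aeval_eq_eval, ← aeval_eq_eval, comp_aeval_apply]

section TangentMap

variable {σ ι : Type*} [Fintype σ] (F : ι → MvPolynomial σ K) (P : σ → K)

/-- The differential at `P` of the polynomial map with components `F`. -/
def tangentMap : (σ → K) →ₗ[K] ι → K :=
  LinearMap.pi fun j => differential P (F j)

theorem tangentMap_apply (v : σ → K) (j : ι) : tangentMap F P v j = differential P (F j) v := rfl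

variable {F} in
theorem tangentMap_self {d : ℕ} (hF : ∀ j, (F j).IsHomogeneous d) :
    tangentMap F P P = (d : K) • fun j => eval P (F j) :=
  funext fun j => differential_self (hF j) P

theorem differential_aeval [Fintype ι] (G : MvPolynomial ι K) :
    differential P (aeval F G) = differential (fun j => eval P (F j)) G ∘ₗ tangentMap F P := by
  ext v
  simp only [LinearMap.comp_apply, differential_apply, tangentMap_apply, derivation_aeval, map_sum,
    map_mul, eval_aeval, Finset.sum_mul, Finset.mul_sum, mul_assoc]
  exact Finset.sum_comm

end TangentMap

theorem range_tangentMap {ι : Type*} (F : ι → MvPolynomial (Fin m) K) (P : Fin m → K) :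
    LinearMap.range (tangentMap F P) =
      Submodule.span K (derivVector F P '' {b | b.degree = 1}) := by
  have hcol (i : Fin m) :
      tangentMap F P (Pi.basisFun K (Fin m) i) = derivVector F P (Finsupp.single i 1) := by
    funext j
    classical
    simp [tangentMap_apply, differential_apply, derivVector, iterDeriv_single_one, Pi.single_apply]
  rw [← Submodule.map_top, ← (Pi.basisFun K (Fin m)).span_eq, Submodule.map_span, ← Set.range_comp]
  rw [← Finsupp.range_single_one, ← Set.range_comp]
  exact congrArg _ (congrArg Set.range (funext hcol))

section Jets

variable {ι : Type*}

theorem span_eq_span_of_dotProduct [Fintype ι] {A B : Set (ι → K)}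
    (h : ∀ w : ι → K, (∀ x ∈ A, w ⬝ᵥ x = 0) ↔ ∀ x ∈ B, w ⬝ᵥ x = 0) :
    Submodule.span K A = Submodule.span K B := by
  classical
  have mem_iff (S : Set (ι → K)) (w : ι → K) : dotProductEquiv K ι w ∈
      (Submodule.span K S).dualAnnihilator ↔ ∀ x ∈ S, w ⬝ᵥ x = 0 := by
    rw [Submodule.mem_dualAnnihilator]
    exact Submodule.span_le (p := LinearMap.ker (dotProductEquiv K ι w))
  rw [← Subspace.dualAnnihilator_inj]
  ext f
  obtain ⟨w, rfl⟩ := (dotProductEquiv K ι).surjective f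
  rw [mem_iff, mem_iff, h]

theorem jetSpan_one (φ : ι → MvPowerSeries (Fin m) K) :
    jetSpan φ 1 = Submodule.span K (Set.range (frame φ)) := by
  have hzero : frame φ 0 = fun j =>
      MvPowerSeries.constantCoeff (iterDeriv seriesPartial 0 (φ j)) := by
    simp only [iterDeriv_zero]; rfl
  have hsucc (i : Fin m) : frame φ i.succ = fun j => MvPowerSeries.constantCoeff
      (iterDeriv seriesPartial (Finsupp.single i 1) (φ j)) := by
    simp only [iterDeriv_single_one]; rfl
  rw [jetSpan]
  congr 1
  ext w
  constructor
  · rintro ⟨a, ha, rfl⟩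
    rcases Nat.le_one_iff_eq_zero_or_eq_one.1 ha with h | h
    · rw [(Finsupp.degree_eq_zero_iff a).1 h]
      exact ⟨0, hzero⟩
    · obtain ⟨i, rfl⟩ := Finsupp.range_single_one.superset h
      exact ⟨i.succ, hsucc i⟩
  · rintro ⟨i, rfl⟩
    refine Fin.cases ⟨0, by simp, hzero⟩ (fun i => ⟨Finsupp.single i 1, by simp, hsucc i⟩) i

theorem jetSpan_one_le_tangentCone [Fintype ι] {T : Set (ℙ K (ι → K))}
    {φ : ι → MvPowerSeries (Fin m) K} (h : ∀ G ∈ vanishingForms T, aeval φ G = 0) :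
    jetSpan φ 1 ≤ tangentCone T fun j => MvPowerSeries.constantCoeff (φ j) := by
  rw [jetSpan_one, Submodule.span_le]
  rintro _ ⟨i, rfl⟩
  refine mem_tangentCone.2 fun G hG => ?_
  obtain ⟨k, hk⟩ := hG.1
  rw [differential_frame hk, h G hG]
  refine Fin.cases ?_ (fun i => ?_) i <;> simp

theorem span_frame_mul_le (g : MvPowerSeries (Fin m) K) (ψ : ι → MvPowerSeries (Fin m) K) :
    Submodule.span K (Set.range (frame fun j => g * ψ j)) ≤
      Submodule.span K (Set.range (frame ψ)) := by
  have hzero : frame (fun j => g * ψ j) 0 = MvPowerSeries.constantCoeff g • frame ψ 0 := by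
    funext j
    simp [frame, jetMatrix]
  have hsucc (i : Fin m) : frame (fun j => g * ψ j) i.succ =
      MvPowerSeries.constantCoeff g • frame ψ i.succ +
        MvPowerSeries.constantCoeff (MvPowerSeries.pderiv K i g) • frame ψ 0 := by
    funext j
    simp [frame, jetMatrix, mul_comm]
  have hmem (i) : frame ψ i ∈ Submodule.span K (Set.range (frame ψ)) :=
    Submodule.subset_span ⟨i, rfl⟩
  rw [Submodule.span_le]
  rintro _ ⟨i, rfl⟩
  refine Fin.cases ?_ (fun i => ?_) i
  · exact hzero ▸ Submodule.smul_mem _ _ (hmem 0)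
  · exact hsucc i ▸ Submodule.add_mem _ (Submodule.smul_mem _ _ (hmem _))
      (Submodule.smul_mem _ _ (hmem 0))

variable [CharZero K] {l d : ℕ} {F : ι → MvPolynomial (Fin l) K}
  {p : Fin l → MvPowerSeries (Fin m) K} {g : MvPowerSeries (Fin m) K}

theorem span_frame_aeval_le (hd : d ≠ 0) (hF : ∀ j, (F j).IsHomogeneous d) :
    Submodule.span K (Set.range (frame fun j => aeval p (F j))) ≤
      (Submodule.span K (Set.range (frame p))).map
        (tangentMap F fun k => MvPowerSeries.constantCoeff (p k)) := by
  set P := fun k => MvPowerSeries.constantCoeff (p k) with hP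
  have hmem (i) : tangentMap F P (frame p i) ∈
      (Submodule.span K (Set.range (frame p))).map (tangentMap F P) :=
    ⟨_, Submodule.subset_span ⟨i, rfl⟩, rfl⟩
  have hzero : tangentMap F P (frame p 0) = (d : K) • frame (fun j => aeval p (F j)) 0 := by
    funext j
    simp [tangentMap_apply, hP, differential_frame (hF j), frame, jetMatrix]
  have hsucc (i : Fin m) :
      tangentMap F P (frame p i.succ) = frame (fun j => aeval p (F j)) i.succ := by
    funext j
    simp [tangentMap_apply, hP, differential_frame (hF j), frame, jetMatrix]
  rw [Submodule.span_le]
  rintro _ ⟨i, rfl⟩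
  refine Fin.cases ?_ (fun i => ?_) i
  · exact (Submodule.smul_mem_iff _ (Nat.cast_ne_zero.2 hd)).1 (hzero ▸ hmem 0)
  · exact hsucc i ▸ hmem i.succ

theorem linearIndependent_frame {p : Fin (m + 1) → MvPowerSeries (Fin m) K}
    {F : ι → MvPolynomial (Fin (m + 1)) K} (hd : d ≠ 0)
    (hF : ∀ j, (F j).IsHomogeneous d)
    (hrank : Module.finrank K (jetSpan (fun j => g * aeval p (F j)) 1) = m + 1) :
    LinearIndependent K (frame p) := by
  have hle := (span_frame_mul_le g fun j => aeval p (F j)).trans (span_frame_aeval_le hd hF)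
  rw [linearIndependent_iff_card_le_finrank_span, Fintype.card_fin]
  rw [jetSpan_one] at hrank
  exact hrank.ge.trans ((Submodule.finrank_mono hle).trans (Submodule.finrank_map_le _ _))

theorem jetSpan_eq_span_derivVector [Finite ι] {p : Fin (m + 1) → MvPowerSeries (Fin m) K}
    {F : ι → MvPolynomial (Fin (m + 1)) K} {s : ℕ} (hs : s < d)
    (hF : ∀ j, (F j).IsHomogeneous d) (hg : IsUnit g) (hp : LinearIndependent K (frame p)) :
    jetSpan (fun j => g * aeval p (F j)) s = Submodule.span K
      (derivVector F (fun k => MvPowerSeries.constantCoeff (p k)) '' {b | b.degree = s}) := by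
  cases nonempty_fintype ι
  refine span_eq_span_of_dotProduct fun w => ?_
  set φ := fun j => g * aeval p (F j)
  have hsum : ∑ j, w j • φ j = g * aeval p (∑ j, w j • F j) := by
    simp only [φ, map_sum, Finset.mul_sum, map_smul, mul_smul_comm]
  have hG : (∑ j, w j • F j).IsHomogeneous d :=
    Submodule.sum_mem (homogeneousSubmodule _ K d) fun j _ => Submodule.smul_mem _ _ (hF j)
  have hjet (a : Fin m →₀ ℕ) :
      MvPowerSeries.constantCoeff (iterDeriv seriesPartial a (∑ j, w j • φ j)) =
        w ⬝ᵥ fun j => MvPowerSeries.constantCoeff (iterDeriv seriesPartial a (φ j)) := by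
    simp [dotProduct, map_sum, map_smul]
  have hderiv (b : Fin (m + 1) →₀ ℕ) (P : Fin (m + 1) → K) :
      eval P (iterDeriv polyPartial b (∑ j, w j • F j)) = w ⬝ᵥ derivVector F P b := by
    simp [dotProduct, map_sum, map_smul, derivVector]
  have horder := natCast_succ_le_order_aeval_iff_iterDeriv hp hG hs
  rw [← order_isUnit_mul hg, ← hsum, natCast_le_order_iff_iterDeriv] at horder
  simp only [hjet, hderiv, Nat.lt_succ_iff] at horder
  rw [Set.forall_mem_image]
  refine Iff.trans ⟨fun h a ha => h _ ⟨a, ha, rfl⟩, ?_⟩ horder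
  rintro h _ ⟨a, ha, rfl⟩
  exact h a ha

end Jets

/-! ### Zariski closures -/

theorem aeval_mul_of_isHomogeneous {ι A : Type*} [CommRing A] [Algebra K A] {k : ℕ}
    {G : MvPolynomial ι K} (hG : G.IsHomogeneous k) (c : A) (x : ι → A) :
    aeval (fun i => c * x i) G = c ^ k * aeval x G := by
  rw [aeval_def, aeval_def, eval₂_eq, eval₂_eq, Finset.mul_sum]
  refine Finset.sum_congr rfl fun a ha => ?_
  simp only [mul_pow, Finset.prod_mul_distrib]
  rw [Finset.prod_pow_eq_pow_sum, ← hG.degree_eq_sum_deg_support ha, mul_left_comm]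

section Zariski

variable {ι : Type*}

theorem vanishesAt_mk {k : ℕ} {G : MvPolynomial ι K} (hG : G.IsHomogeneous k) {v : ι → K}
    (hv : v ≠ 0) : VanishesAt G (Projectivization.mk K v hv) ↔ eval v G = 0 := by
  obtain ⟨a, ha⟩ := Projectivization.exists_smul_eq_mk_rep K v hv
  have hscale := aeval_mul_of_isHomogeneous hG (a : K) v
  rw [aeval_eq_eval, aeval_eq_eval] at hscale
  rw [VanishesAt, ← ha]
  change eval (fun i => (a : K) * v i) G = 0 ↔ _
  rw [hscale, mul_eq_zero, or_iff_right (pow_ne_zero _ a.ne_zero)]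

theorem mem_zariskiClosure {T : Set (ℙ K (ι → K))} {x : ℙ K (ι → K)} :
    x ∈ zariskiClosure T ↔ ∀ G ∈ vanishingForms T, VanishesAt G x := by
  constructor
  · intro h G hG
    exact h {x | ∀ H ∈ ({G} : Set (MvPolynomial ι K)), VanishesAt H x}
      ⟨⟨_, by rintro _ rfl; exact hG.1, rfl⟩, by rintro y hy _ rfl; exact hG.2 y hy⟩ G rfl
  · rintro h _ ⟨⟨S, hS, rfl⟩, hT⟩ G hG
    exact h G ⟨hS G hG, fun y hy => hT hy G hG⟩

theorem subset_zariskiClosure (T : Set (ℙ K (ι → K))) : T ⊆ zariskiClosure T :=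
  fun _ hx => Set.mem_sInter.2 fun _ hZ => hZ.2 hx

theorem mem_vanishingForms_of_aeval_eq_zero {F : ι → MvPolynomial (Fin m) K} {k : ℕ}
    {G : MvPolynomial ι K} (hG : G.IsHomogeneous k) (h : aeval F G = 0) :
    G ∈ vanishingForms (imageVariety F) := by
  refine ⟨⟨k, hG⟩, fun x hx => mem_zariskiClosure.1 hx G ⟨⟨k, hG⟩, ?_⟩⟩
  rintro _ ⟨P, hP, rfl⟩
  rw [vanishesAt_mk hG hP, ← eval_aeval, h, map_zero]

theorem eq_zero_of_eval_torus [Infinite K] {H : MvPolynomial (Fin m) K}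
    (h : ∀ P : Fin m → K, (∀ i, P i ≠ 0) → eval P H = 0) : H = 0 := by
  refine funext_set (fun _ => {0}ᶜ) (fun _ => (Set.finite_singleton _).infinite_compl)
    fun P hP => ?_
  rw [map_zero]
  exact h P fun i => hP i (Set.mem_univ i)

end Zariski

/-! ### Rational maps with a linear inverse on the torus -/

/-- The forms `F j` of degree `e + 1` define a rational map which is inverted, up to the factor `c`,
by the linear forms `ℓ i`, and `c` has no zeros on the torus, where all coordinates are nonzero.
The torus is then embedded by `F`. -/
structure HasLinearInverse {ι : Type*} (F : ι → MvPolynomial (Fin m) K) (e : ℕ)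
    (c : MvPolynomial (Fin m) K) (ℓ : Fin m → MvPolynomial ι K) : Prop where
  isHomogeneous : ∀ j, (F j).IsHomogeneous (e + 1)
  isHomogeneous_factor : c.IsHomogeneous e
  isHomogeneous_inverse : ∀ i, (ℓ i).IsHomogeneous 1
  aeval_inverse : ∀ i, aeval F (ℓ i) = c * X i
  eval_factor_ne_zero : ∀ P : Fin m → K, (∀ i, P i ≠ 0) → eval P c ≠ 0

theorem exists_hasLinearInverse {ι : Type*} [Finite ι] {W : Submodule K (MvPolynomial (Fin m) K)}
    (F : Module.Basis ι K W) {e : ℕ} (hW : W ≤ homogeneousSubmodule (Fin m) K (e + 1))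
    {c : MvPolynomial (Fin m) K} (hc : c.IsHomogeneous e)
    (hc0 : ∀ P : Fin m → K, (∀ i, P i ≠ 0) → eval P c ≠ 0) (hcW : ∀ i, c * X i ∈ W) :
    ∃ ℓ, HasLinearInverse (fun j => (F j : MvPolynomial (Fin m) K)) e c ℓ := by
  cases nonempty_fintype ι
  refine ⟨fun i => ∑ j, C (F.repr ⟨_, hcW i⟩ j) * X j, fun j => hW (F j).2, hc,
    fun i => IsHomogeneous.sum _ _ _ fun j _ => isHomogeneous_C_mul_X _ _, fun i => ?_, hc0⟩
  have hrepr := congrArg Subtype.val (F.sum_repr ⟨_, hcW i⟩)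
  rw [Submodule.coe_sum] at hrepr
  simpa only [map_sum, map_mul, aeval_C, aeval_X, algebraMap_eq, Submodule.coe_smul,
    smul_eq_C_mul] using hrepr

/-- The points of projective space at which one of the linear forms `ℓ i` vanishes. -/
def coordinateBoundary {ι : Type*} (ℓ : Fin m → MvPolynomial ι K) : Set (ℙ K (ι → K)) :=
  {x | VanishesAt (∏ i, ℓ i) x}

theorem notMem_coordinateBoundary {ι : Type*} {ℓ : Fin m → MvPolynomial ι K}
    {x : ℙ K (ι → K)} : x ∉ coordinateBoundary ℓ ↔ ∀ i, eval x.rep (ℓ i) ≠ 0 := by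
  simp [coordinateBoundary, VanishesAt, Finset.prod_eq_zero_iff]

namespace HasLinearInverse

variable {ι : Type*} {e : ℕ} {F : ι → MvPolynomial (Fin m) K}
  {c : MvPolynomial (Fin m) K} {ℓ : Fin m → MvPolynomial ι K}

theorem eval_inverse (h : HasLinearInverse F e c ℓ) (P : Fin m → K) (i : Fin m) :
    eval (fun j => eval P (F j)) (ℓ i) = eval P c * P i := by
  rw [← eval_aeval, h.aeval_inverse, map_mul, eval_X]

theorem isHomogeneous_prod (h : HasLinearInverse F e c ℓ) :
    (∏ i, ℓ i).IsHomogeneous (∑ _i : Fin m, 1) :=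
  IsHomogeneous.prod _ _ _ fun i _ => h.isHomogeneous_inverse i

theorem isZariskiClosed_coordinateBoundary (h : HasLinearInverse F e c ℓ) :
    IsZariskiClosed (coordinateBoundary ℓ) :=
  ⟨{∏ i, ℓ i}, by rintro _ rfl; exact ⟨_, h.isHomogeneous_prod⟩, by simp [coordinateBoundary]⟩

theorem mk_notMem_coordinateBoundary (h : HasLinearInverse F e c ℓ) {v : ι → K} {hv : v ≠ 0} :
    Projectivization.mk K v hv ∉ coordinateBoundary ℓ ↔ ∀ i, eval v (ℓ i) ≠ 0 := by
  rw [coordinateBoundary, Set.mem_ofPred_eq, vanishesAt_mk h.isHomogeneous_prod, map_prod,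
    Finset.prod_eq_zero_iff]
  simp

theorem eval_ne_zero [NeZero m] (h : HasLinearInverse F e c ℓ) {P : Fin m → K}
    (hP : ∀ i, P i ≠ 0) : (fun j => eval P (F j)) ≠ 0 := by
  intro h0
  have hinv := h.eval_inverse P 0
  have hzero : eval (0 : ι → K) (ℓ 0) = 0 := by
    rw [eval_zero, constantCoeff_eq, (h.isHomogeneous_inverse 0).coeff_eq_zero]
    simp
  rw [h0, hzero] at hinv
  exact mul_ne_zero (h.eval_factor_ne_zero P hP) (hP 0) hinv.symm

theorem mk_mem_diff_coordinateBoundary [NeZero m] (h : HasLinearInverse F e c ℓ) {P : Fin m → K}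
    (hP : ∀ i, P i ≠ 0) :
    Projectivization.mk K _ (h.eval_ne_zero hP) ∈ imageVariety F \ coordinateBoundary ℓ := by
  refine ⟨subset_zariskiClosure _ ⟨P, h.eval_ne_zero hP, rfl⟩,
    h.mk_notMem_coordinateBoundary.2 fun i => ?_⟩
  rw [h.eval_inverse]
  exact mul_ne_zero (h.eval_factor_ne_zero P hP) (hP i)

theorem aeval_eq_zero [Infinite K] [NeZero m] (h : HasLinearInverse F e c ℓ)
    {G : MvPolynomial ι K} (hG : G ∈ vanishingForms (imageVariety F \ coordinateBoundary ℓ)) :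
    aeval F G = 0 := by
  refine eq_zero_of_eval_torus fun P hP => ?_
  obtain ⟨k, hk⟩ := hG.1
  rw [eval_aeval, ← vanishesAt_mk hk (h.eval_ne_zero hP)]
  exact hG.2 _ (h.mk_mem_diff_coordinateBoundary hP)

theorem subset_zariskiClosure_diff_coordinateBoundary [Infinite K] [NeZero m]
    (h : HasLinearInverse F e c ℓ) :
    imageVariety F ⊆ zariskiClosure (imageVariety F \ coordinateBoundary ℓ) := by
  refine fun x hx => mem_zariskiClosure.2 fun G hG => ?_
  obtain ⟨k, hk⟩ := hG.1
  exact (mem_vanishingForms_of_aeval_eq_zero hk (h.aeval_eq_zero hG)).2 x hx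

theorem relation_mem_vanishingForms (h : HasLinearInverse F e c ℓ) (j : ι) :
    X j * aeval ℓ c - aeval ℓ (F j) ∈ vanishingForms (imageVariety F) := by
  have hleft : (X j * aeval ℓ c : MvPolynomial ι K).IsHomogeneous (e + 1) := by
    simpa [add_comm] using
      (isHomogeneous_X K j).mul (h.isHomogeneous_factor.aeval ℓ h.isHomogeneous_inverse)
  have hright : (aeval ℓ (F j)).IsHomogeneous (e + 1) := by
    simpa using (h.isHomogeneous j).aeval ℓ h.isHomogeneous_inverse
  refine mem_vanishingForms_of_aeval_eq_zero (hleft.sub hright) ?_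
  rw [map_sub, map_mul, aeval_X, comp_aeval_apply, comp_aeval_apply]
  simp only [h.aeval_inverse]
  rw [aeval_mul_of_isHomogeneous h.isHomogeneous_factor,
    aeval_mul_of_isHomogeneous (h.isHomogeneous j), aeval_X_left_apply, aeval_X_left_apply]
  ring

theorem aeval_relation {A : Type*} [CommRing A] [Algebra K A] (h : HasLinearInverse F e c ℓ)
    {y : ι → A} (hy : ∀ G ∈ vanishingForms (imageVariety F), aeval y G = 0) (j : ι) :
    y j * aeval (fun i => aeval y (ℓ i)) c = aeval (fun i => aeval y (ℓ i)) (F j) := by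
  have hrel := hy _ (h.relation_mem_vanishingForms j)
  rwa [map_sub, map_mul, aeval_X, comp_aeval_apply, comp_aeval_apply, sub_eq_zero] at hrel

theorem tangentMap_injective [Finite ι] [CharZero K] [NeZero m] (h : HasLinearInverse F e c ℓ)
    {P : Fin m → K} (hP : ∀ i, P i ≠ 0) : Function.Injective (tangentMap F P) := by
  cases nonempty_fintype ι
  have hc := h.eval_factor_ne_zero P hP
  rw [← LinearMap.ker_eq_bot, LinearMap.ker_eq_bot']
  intro v hv
  have hvP : v = (-(differential P c v / eval P c)) • P := by
    funext i
    have hd := LinearMap.congr_fun (congrArg (differential P) (h.aeval_inverse i)) v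
    rw [differential_aeval, LinearMap.comp_apply, hv, map_zero, differential_mul,
      differential_X] at hd
    simp only [LinearMap.add_apply, LinearMap.smul_apply, LinearMap.proj_apply, eval_X,
      smul_eq_mul] at hd
    rw [Pi.smul_apply, smul_eq_mul]
    field_simp
    linear_combination -hd
  rw [hvP, map_smul, tangentMap_self P h.isHomogeneous, smul_smul, smul_eq_zero,
    or_iff_left (h.eval_ne_zero hP), mul_eq_zero,
    or_iff_left (Nat.cast_ne_zero.2 e.succ_ne_zero)] at hv
  rw [hvP, hv, zero_smul]

theorem tangentCone_le_range_tangentMap [Fintype ι] [CharZero K] (h : HasLinearInverse F e c ℓ)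
    {y : ι → K} (hy : ∀ j, y j * eval (fun i => eval y (ℓ i)) c =
      eval (fun i => eval y (ℓ i)) (F j)) (hc : eval (fun i => eval y (ℓ i)) c ≠ 0) :
    tangentCone (imageVariety F) y ≤
      LinearMap.range (tangentMap F fun i => eval y (ℓ i)) := by
  intro w hw
  set P : Fin m → K := fun i => eval y (ℓ i)
  set z := tangentMap ℓ y w
  have hself : tangentMap F P P = (((e + 1 : ℕ) : K) * eval P c) • y := by
    rw [tangentMap_self P h.isHomogeneous, mul_smul]
    congr 1
    exact funext fun j => by rw [← hy, Pi.smul_apply, smul_eq_mul, mul_comm]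
  have hw' : eval P c • w = tangentMap F P z - differential P c z • y := by
    funext j
    have hdiff := mem_tangentCone.1 hw _ (h.relation_mem_vanishingForms j)
    simp only [differential_sub, differential_mul, differential_X, differential_aeval, eval_X,
      eval_aeval, LinearMap.sub_apply, LinearMap.add_apply, LinearMap.smul_apply,
      LinearMap.comp_apply, LinearMap.proj_apply, smul_eq_mul] at hdiff
    simp only [Pi.sub_apply, Pi.smul_apply, smul_eq_mul, tangentMap_apply]
    linear_combination hdiff
  have hyrange : y ∈ LinearMap.range (tangentMap F P) :=
    (Submodule.smul_mem_iff _ (mul_ne_zero (Nat.cast_ne_zero.2 e.succ_ne_zero) hc)).1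
      (hself ▸ LinearMap.mem_range_self _ P)
  rw [← Submodule.smul_mem_iff _ hc, hw']
  exact Submodule.sub_mem _ (LinearMap.mem_range_self _ z) (Submodule.smul_mem _ _ hyrange)

end HasLinearInverse

/-! ### Local parametrizations and Laplace equations -/

section AffineChart

variable {n : ℕ}

/-- The affine chart `(P₀, P₁ + t₁, …, Pₙ + tₙ)` around `P`. -/
def affineChart (P : Fin (n + 1) → K) : Fin (n + 1) → MvPowerSeries (Fin n) K :=
  Fin.cons (MvPowerSeries.C (P 0)) fun i => MvPowerSeries.C (P i.succ) + MvPowerSeries.X i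

theorem constantCoeff_affineChart (P : Fin (n + 1) → K) :
    (fun k => MvPowerSeries.constantCoeff (affineChart P k)) = P := by
  funext k
  refine Fin.cases ?_ (fun i => ?_) k <;> simp [affineChart]

theorem frame_affineChart (P : Fin (n + 1) → K) :
    frame (affineChart P) = Fin.cons P fun i => Pi.single i.succ 1 := by
  classical
  funext i
  refine Fin.cases (constantCoeff_affineChart P) (fun i => ?_) i
  funext k
  refine Fin.cases ?_ (fun j => ?_) k
  · simp [affineChart, frame, jetMatrix]
  · rcases eq_or_ne j i with rfl | hij
    · simp [affineChart, frame, jetMatrix]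
    · simp [affineChart, frame, jetMatrix, MvPowerSeries.pderiv_X_of_ne hij, hij]

theorem linearIndependent_frame_affineChart {P : Fin (n + 1) → K} (hP : P 0 ≠ 0) :
    LinearIndependent K (frame (affineChart P)) := by
  rw [frame_affineChart, linearIndependent_finCons]
  refine ⟨(Pi.linearIndependent_single_one (Fin (n + 1)) K).comp _ (Fin.succ_injective n),
    fun hspan => hP ?_⟩
  have hle : Submodule.span K (Set.range fun i : Fin n => (Pi.single i.succ 1 : Fin (n + 1) → K)) ≤
      LinearMap.ker (LinearMap.proj 0 : (Fin (n + 1) → K) →ₗ[K] K) := by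
    rw [Submodule.span_le]
    rintro _ ⟨i, rfl⟩
    simp
  exact hle hspan

end AffineChart

namespace HasLinearInverse

variable [CharZero K] {n e : ℕ} {ι : Type*} [Fintype ι] {F : ι → MvPolynomial (Fin (n + 1)) K}
  {c : MvPolynomial (Fin (n + 1)) K} {ℓ : Fin (n + 1) → MvPolynomial ι K}

theorem exists_isLocalParametrization (h : HasLinearInverse F e c ℓ) (he : e ≠ 0)
    {x : ℙ K (ι → K)} (hx : x ∈ imageVariety F \ coordinateBoundary ℓ) :
    ∃ φ : ι → MvPowerSeries (Fin n) K, IsLocalParametrization (imageVariety F) x φ := by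
  set P : Fin (n + 1) → K := fun i => eval x.rep (ℓ i)
  have hP : ∀ i, P i ≠ 0 := notMem_coordinateBoundary.1 hx.2
  have hc := h.eval_factor_ne_zero P hP
  have hrel : ∀ j, x.rep j * eval P c = eval P (F j) := by
    have hy : ∀ G ∈ vanishingForms (imageVariety F), aeval x.rep G = 0 := fun G hG => by
      rw [aeval_eq_eval]
      exact hG.2 x hx.1
    simpa only [aeval_eq_eval] using h.aeval_relation hy
  set g : MvPowerSeries (Fin n) K := MvPowerSeries.C (eval P c)⁻¹
  have hg : IsUnit g := MvPowerSeries.isUnit_iff_constantCoeff.2 (by simpa [g] using hc)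
  set φ : ι → MvPowerSeries (Fin n) K := fun j => g * aeval (affineChart P) (F j)
  have hφ : (fun j => MvPowerSeries.constantCoeff (φ j)) = x.rep := by
    funext j
    simp only [φ, g, map_mul, MvPowerSeries.constantCoeff_C, constantCoeff_aeval,
      constantCoeff_affineChart, ← hrel]
    field_simp
  have heq : ∀ G ∈ vanishingForms (imageVariety F), aeval φ G = 0 := by
    intro G hG
    obtain ⟨k, hk⟩ := hG.1
    rw [aeval_mul_of_isHomogeneous hk, ← comp_aeval_apply,
      h.aeval_eq_zero ⟨hG.1, fun y hy => hG.2 y hy.1⟩, map_zero, mul_zero]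
  have hjet : jetSpan φ 1 = LinearMap.range (tangentMap F P) := by
    rw [range_tangentMap, jetSpan_eq_span_derivVector (by omega) h.isHomogeneous hg
      (linearIndependent_frame_affineChart (hP 0)), constantCoeff_affineChart]
  refine ⟨φ, hx.1, ⟨hφ ▸ x.rep_nonzero, ?_⟩, heq, ?_, ?_⟩
  · simp only [hφ, Projectivization.mk_rep]
  · refine le_antisymm (jetSpan_one_le_tangentCone heq) ?_
    rw [hφ, hjet]
    exact h.tangentCone_le_range_tangentMap hrel hc
  · rw [hjet, LinearMap.finrank_range_of_inj (h.tangentMap_injective hP),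
      Module.finrank_fintype_fun_eq_card, Fintype.card_fin]

theorem exists_jetSpan_eq (h : HasLinearInverse F e c ℓ) {x : ℙ K (ι → K)}
    (hx : x ∉ coordinateBoundary ℓ) {φ : ι → MvPowerSeries (Fin n) K}
    (hφ : IsLocalParametrization (imageVariety F) x φ) :
    ∃ P : Fin (n + 1) → K, (∀ i, P i ≠ 0) ∧
      jetSpan φ e = Submodule.span K (derivVector F P '' {b | b.degree = e}) := by
  set p : Fin (n + 1) → MvPowerSeries (Fin n) K := fun i => aeval φ (ℓ i) with hp
  have hP : ∀ i, MvPowerSeries.constantCoeff (p i) ≠ 0 := by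
    obtain ⟨h0, rfl⟩ := hφ.base
    simpa only [hp, constantCoeff_aeval] using h.mk_notMem_coordinateBoundary.1 hx
  have hcp : IsUnit (aeval p c) := by
    rw [MvPowerSeries.isUnit_iff_constantCoeff, constantCoeff_aeval, isUnit_iff_ne_zero]
    exact h.eval_factor_ne_zero _ hP
  obtain ⟨g, hg⟩ := hcp.exists_left_inv
  have hφp : φ = fun j => g * aeval p (F j) := by
    funext j
    rw [← h.aeval_relation hφ.equations, mul_left_comm, hg, mul_one]
  rw [hφp] at hφ ⊢
  exact ⟨_, hP, jetSpan_eq_span_derivVector e.lt_succ_self h.isHomogeneous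
    (IsUnit.of_mul_eq_one _ hg)
    (linearIndependent_frame e.succ_ne_zero h.isHomogeneous hφ.finrank_tangent)⟩

theorem satisfiesLaplaceEquations {I : Ideal (MvPolynomial (Fin (n + 1)) K)}
    (hI : I.IsHomogeneous (homogeneousSubmodule (Fin (n + 1)) K))
    {F : Module.Basis ι K (inverseSystemDeg I (e + 1))}
    (h : HasLinearInverse (fun j => (F j : MvPolynomial (Fin (n + 1)) K)) e c ℓ) (he : e ≠ 0)
    {δ : ℕ} (hcolon : ∀ P : Fin (n + 1) → K, (∀ i, P i ≠ 0) →
      Module.finrank K (colonDeg I (linearForm P) e) = δ) :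
    SatisfiesLaplaceEquations
      (imageVariety fun j => (F j : MvPolynomial (Fin (n + 1)) K)) n e δ := by
  refine ⟨⟨_, (h.mk_mem_diff_coordinateBoundary (P := 1) (by simp)).1⟩, coordinateBoundary ℓ,
    h.isZariskiClosed_coordinateBoundary, h.subset_zariskiClosure_diff_coordinateBoundary,
    fun x hx => ⟨h.exists_isLocalParametrization he hx, fun φ hφ => ?_⟩⟩
  obtain ⟨P, hP, hjet⟩ := h.exists_jetSpan_eq hx.2 hφ
  have hrank := finrank_span_derivVector_add_finrank_colonDeg hI F P
  rw [← hjet, hcolon P hP, Nat.add_right_comm, Nat.add_sub_cancel] at hrank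
  rw [osculatingDim, ← hrank]
  push_cast
  ring

end HasLinearInverse

/-! ### The Togliatti ideal -/

theorem monomial_mem_inverseSystemDeg [CharZero K] {S : Set (Fin m →₀ ℕ)} {a : Fin m →₀ ℕ}
    (ha : ∀ s ∈ S, ¬s ≤ a) :
    monomial a (1 : K) ∈
      inverseSystemDeg (Ideal.span ((fun s => monomial s (1 : K)) '' S)) a.degree := by
  classical
  refine mem_inverseSystemDeg.2
    ⟨fun α hα => apolarHom_eq_zero_of_mem (fun β hβ => ?_) hα, isHomogeneous_monomial _ rfl⟩
  rw [constantCoeff_apolarHom]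
  refine Finset.sum_eq_zero fun b hb => ?_
  obtain ⟨s, hs, hsb⟩ := mem_ideal_span_monomial_image.1 hβ b hb
  have hab : a ≠ b := fun h => ha s hs (h ▸ hsb)
  rw [coeff_monomial, if_neg hab, mul_zero, mul_zero]

theorem mem_span_singleton_of_dvd {D f : MvPolynomial (Fin m) K} {k : ℕ}
    (hD : D.IsHomogeneous k) (hf : f.IsHomogeneous k) (h : f ∣ D) :
    D ∈ Submodule.span K {f} := by
  obtain ⟨q, rfl⟩ := h
  rcases eq_or_ne (f * q) 0 with h0 | h0
  · rw [h0]
    exact Submodule.zero_mem _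
  have hq : q.totalDegree = 0 := by
    have hdeg := totalDegree_mul_of_isDomain (left_ne_zero_of_mul h0) (right_ne_zero_of_mul h0)
    rw [hD.totalDegree h0, hf.totalDegree (left_ne_zero_of_mul h0)] at hdeg
    omega
  rw [totalDegree_eq_zero_iff_eq_C.1 hq, mul_comm, ← smul_eq_C_mul]
  exact Submodule.smul_mem _ _ (Submodule.mem_span_singleton_self f)

section Togliatti

variable {n d : ℕ}

/-- The exponents of the monomial generators `x_i ^ d` and `x₀ ^ (d - 1) * x_i` of
`togliattiIdeal`. -/
def togliattiExponents (n d : ℕ) : Set (Fin (n + 1) →₀ ℕ) :=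
  Set.range (fun i => Finsupp.single i d) ∪
    Set.range fun i => Finsupp.single 0 (d - 1) + Finsupp.single i 1

theorem togliattiIdeal_eq_span_monomial (n d : ℕ) : togliattiIdeal K n d =
    Ideal.span ((fun s => monomial s (1 : K)) '' togliattiExponents n d) := by
  rw [togliattiIdeal, Ideal.span_mul_span', Set.singleton_mul, ← Ideal.span_union,
    togliattiExponents, Set.image_union]
  simp only [← Set.range_comp, Function.comp_def, X_pow_eq_monomial]
  simp only [X, monomial_mul, one_mul]

theorem degree_of_mem_togliattiExponents (hd : 1 ≤ d) {s : Fin (n + 1) →₀ ℕ}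
    (hs : s ∈ togliattiExponents n d) : s.degree = d := by
  rcases hs with ⟨i, rfl⟩ | ⟨i, rfl⟩
  · exact Finsupp.degree_single _ _
  · rw [map_add, Finsupp.degree_single, Finsupp.degree_single, Nat.sub_add_cancel hd]

theorem isHomogeneous_togliattiIdeal (hd : 1 ≤ d) :
    (togliattiIdeal K n d).IsHomogeneous (homogeneousSubmodule (Fin (n + 1)) K) := by
  rw [togliattiIdeal_eq_span_monomial]
  refine Ideal.homogeneous_span _ _ ?_
  rintro _ ⟨s, hs, rfl⟩
  exact ⟨d, isHomogeneous_monomial (1 : K) (degree_of_mem_togliattiExponents hd hs)⟩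

theorem X_pow_notMem_togliattiIdeal (hd : 1 ≤ d) :
    (X 0 ^ (d - 1) : MvPolynomial (Fin (n + 1)) K) ∉ togliattiIdeal K n d := by
  classical
  rw [togliattiIdeal_eq_span_monomial, X_pow_eq_monomial, mem_ideal_span_monomial_image]
  intro h
  obtain ⟨s, hs, hle⟩ := h (Finsupp.single 0 (d - 1)) (by simp)
  have hdeg := Finsupp.degree_mono hle
  rw [degree_of_mem_togliattiExponents hd hs, Finsupp.degree_single] at hdeg
  omega

theorem mem_togliattiExponents_of_mem_support (hd : 1 ≤ d) {E : MvPolynomial (Fin (n + 1)) K}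
    (hE : E ∈ togliattiIdeal K n d) (hE' : E.IsHomogeneous d) {a : Fin (n + 1) →₀ ℕ}
    (ha : a ∈ E.support) : a ∈ togliattiExponents n d := by
  rw [togliattiIdeal_eq_span_monomial] at hE
  obtain ⟨s, hs, hsa⟩ := mem_ideal_span_monomial_image.1 hE a ha
  have hadeg : a.degree = d := by
    by_contra h
    exact mem_support_iff.1 ha (hE'.coeff_eq_zero h)
  have hdiff : a - s = 0 := by
    have hdeg := congrArg Finsupp.degree (add_tsub_cancel_of_le hsa)
    rw [map_add, degree_of_mem_togliattiExponents hd hs,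
      hadeg, Nat.add_eq_left] at hdeg
    exact (Finsupp.degree_eq_zero_iff _).1 hdeg
  rwa [← add_tsub_cancel_of_le hsa, hdiff, add_zero]

theorem exists_eq_X_pow_mul_add_sum (hd : 1 ≤ d) {E : MvPolynomial (Fin (n + 1)) K}
    (hE : E ∈ togliattiIdeal K n d) (hE' : E.IsHomogeneous d) :
    ∃ (Q : MvPolynomial (Fin (n + 1)) K) (μ : Fin n → K),
      E = X 0 ^ (d - 1) * Q + ∑ i, μ i • X i.succ ^ d := by
  have hmem : E ∈ (Ideal.span {X 0 ^ (d - 1)}).restrictScalars K ⊔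
      Submodule.span K (Set.range fun i : Fin n => (X i.succ ^ d :
        MvPolynomial (Fin (n + 1)) K)) := by
    rw [E.as_sum]
    refine Submodule.sum_mem _ fun a ha => ?_
    rw [← mul_one (coeff a E), ← smul_eq_mul, ← smul_monomial]
    refine Submodule.smul_mem _ _ ?_
    have hX0 (ha : Finsupp.single 0 (d - 1) ≤ a) :
        monomial a (1 : K) ∈ Ideal.span {(X 0 ^ (d - 1) : MvPolynomial (Fin (n + 1)) K)} := by
      rw [Ideal.mem_span_singleton, X_pow_eq_monomial, monomial_dvd_monomial]
      exact ⟨Or.inr ha, dvd_rfl⟩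
    rcases mem_togliattiExponents_of_mem_support hd hE hE' ha with ⟨i, rfl⟩ | ⟨i, rfl⟩
    · cases i using Fin.cases with
      | zero => exact Submodule.mem_sup_left (hX0 (Finsupp.single_mono (Nat.sub_le _ _)))
      | succ i =>
        rw [← X_pow_eq_monomial]
        exact Submodule.mem_sup_right (Submodule.subset_span ⟨i, rfl⟩)
    · exact Submodule.mem_sup_left (hX0 le_self_add)
  obtain ⟨_, hQ, _, hμ, rfl⟩ := Submodule.mem_sup.1 hmem
  obtain ⟨Q, rfl⟩ := Ideal.mem_span_singleton.1 hQ
  obtain ⟨μ, rfl⟩ := (Submodule.mem_span_range_iff_exists_fun K).1 hμ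
  exact ⟨Q, μ, rfl⟩

theorem add_add_eq_zero_of_power_sums (hd : d ≠ 0) {μ : Fin n → K}
    (h : ∀ t : Fin n → K, ∑ i, t i = 0 → ∑ i, μ i * t i ^ d = 0) {i j k : Fin n} (hij : i ≠ j)
    (hik : i ≠ k) (hjk : j ≠ k) {x y z : K} (hxyz : x + y + z = 0) :
    μ i * x ^ d + μ j * y ^ d + μ k * z ^ d = 0 := by
  have hsum := h (Pi.single i x + Pi.single j y + Pi.single k z)
    (by simpa [Finset.sum_add_distrib] using hxyz)
  rw [← Finset.sum_subset (Finset.subset_univ {i, j, k}) fun l _ hl => ?_,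
    Finset.sum_insert (by simp [hij, hik]), Finset.sum_pair hjk, ← add_assoc] at hsum
  · simpa [hij, hik, hjk, hij.symm, hik.symm, hjk.symm] using hsum
  · simp only [Finset.mem_insert, Finset.mem_singleton, not_or] at hl
    simp [hl.1, hl.2.1, hl.2.2, hd]

theorem eq_zero_of_power_sums [CharZero K] (hn : 3 ≤ n) (hd : 2 ≤ d) {μ : Fin n → K}
    (h : ∀ t : Fin n → K, ∑ i, t i = 0 → ∑ i, μ i * t i ^ d = 0) : μ = 0 := by
  funext k
  obtain ⟨i, j, hik, hjk, hij⟩ : ∃ i j, i ≠ k ∧ j ≠ k ∧ i ≠ j := by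
    obtain ⟨i, hi, j, hj, hij⟩ := Finset.one_lt_card.1
      (show 1 < (Finset.univ.erase k).card by simp; omega)
    exact ⟨i, j, Finset.ne_of_mem_erase hi, Finset.ne_of_mem_erase hj, hij⟩
  have hd0 : d ≠ 0 := by omega
  have hxyz {x y z : K} :=
    add_add_eq_zero_of_power_sums hd0 h hij hik hjk (x := x) (y := y) (z := z)
  have hi : μ i + μ k * (-1) ^ d = 0 := by
    simpa [hd0] using hxyz (x := 1) (y := 0) (z := -1) (by ring)
  have hj : μ j + μ k * (-1) ^ d = 0 := by
    simpa [hd0] using hxyz (x := 0) (y := 1) (z := -1) (by ring)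
  have hijk : μ i + μ j + μ k * ((-1) ^ d * 2 ^ d) = 0 := by
    simpa [← mul_pow] using hxyz (x := 1) (y := 1) (z := -2) (by ring)
  have hpow : (2 : K) ^ d ≠ 2 := by
    have : 2 ^ 2 ≤ 2 ^ d := Nat.pow_le_pow_right two_pos hd
    exact_mod_cast (by omega : 2 ^ d ≠ 2)
  have hk : μ k * ((-1) ^ d * (2 ^ d - 2)) = 0 := by linear_combination hijk - hi - hj
  exact (mul_eq_zero.1 hk).resolve_right
    (mul_ne_zero (pow_ne_zero _ (neg_ne_zero.2 one_ne_zero)) (sub_ne_zero.2 hpow))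

/-- On the hyperplane `x₀ = 0`, restrict to the zeros of the linear form. -/
theorem eq_zero_of_linearForm_mul_eq [CharZero K] (hn : 3 ≤ n) (hd : 2 ≤ d)
    {P : Fin (n + 1) → K} (hP : ∀ i, P i ≠ 0) {D Q : MvPolynomial (Fin (n + 1)) K}
    {μ : Fin n → K}
    (h : linearForm P * D = X 0 ^ (d - 1) * Q + ∑ i, μ i • X i.succ ^ d) : μ = 0 := by
  suffices hν : (fun i => μ i / P i.succ ^ d) = 0 by
    funext i
    exact (div_eq_zero_iff.1 (congrFun hν i)).resolve_right (pow_ne_zero _ (hP _))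
  refine eq_zero_of_power_sums hn hd fun t ht => ?_
  set x : Fin (n + 1) → K := Fin.cons 0 fun i => t i / P i.succ
  have hL : eval x (linearForm P) = 0 := by
    simpa [linearForm, Fin.sum_univ_succ, x, mul_div_cancel₀ _ (hP _)] using ht
  have heval := congrArg (eval x) h
  rw [map_mul, hL, zero_mul] at heval
  rw [heval]
  simp [x, smul_eval, show d - 1 ≠ 0 by omega, div_pow, div_mul_eq_mul_div, mul_div_assoc]

theorem X_pow_dvd_of_dvd_linearForm_mul {P : Fin m → K} {i j : Fin m} (hij : i ≠ j)
    (hP : P j ≠ 0) {D : MvPolynomial (Fin m) K} {k : ℕ} (h : X i ^ k ∣ linearForm P * D) :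
    X i ^ k ∣ D := by
  refine X_prime.pow_dvd_of_dvd_mul_left _ ?_ h
  rintro ⟨q, hq⟩
  have heval := congrArg (eval (Pi.single j 1)) hq
  exact hP (by simpa [linearForm, Pi.single_apply, hij] using heval)

theorem colonDeg_togliattiIdeal [CharZero K] (hn : 3 ≤ n) (hd : 2 ≤ d)
    {P : Fin (n + 1) → K} (hP : ∀ i, P i ≠ 0) :
    colonDeg (togliattiIdeal K n d) (linearForm P) (d - 1) =
      Submodule.span K {X 0 ^ (d - 1)} := by
  have hX0 := isHomogeneous_X_pow (R := K) (0 : Fin (n + 1)) (d - 1)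
  refine le_antisymm (fun D hD => ?_) ?_
  · obtain ⟨hD, hLD⟩ := mem_colonDeg.1 hD
    have hLD' : (linearForm P * D).IsHomogeneous d := by
      simpa [show 1 + (d - 1) = d by omega] using (isHomogeneous_linearForm P).mul hD
    obtain ⟨Q, μ, hQ⟩ := exists_eq_X_pow_mul_add_sum (by omega) hLD hLD'
    obtain rfl := eq_zero_of_linearForm_mul_eq hn hd hP hQ
    refine mem_span_singleton_of_dvd hD hX0
      (X_pow_dvd_of_dvd_linearForm_mul (j := Fin.last n) ?_ (hP _) ⟨Q, by simpa using hQ⟩)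
    have : NeZero n := ⟨by omega⟩
    exact Fin.last_pos'.ne
  · rw [Submodule.span_le, Set.singleton_subset_iff]
    refine mem_colonDeg.2 ⟨hX0, Ideal.mem_sup_right ?_⟩
    rw [linearForm, Finset.sum_mul]
    refine Ideal.sum_mem _ fun i _ => ?_
    rw [mul_assoc, mul_comm (X i)]
    exact Ideal.mul_mem_left _ _
      (Ideal.mul_mem_mul (Ideal.subset_span rfl) (Ideal.subset_span ⟨i, rfl⟩))

theorem finrank_colonDeg_togliattiIdeal [CharZero K] (hn : 3 ≤ n) (hd : 2 ≤ d)
    {P : Fin (n + 1) → K} (hP : ∀ i, P i ≠ 0) :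
    Module.finrank K (colonDeg (togliattiIdeal K n d) (linearForm P) (d - 1)) = 1 := by
  rw [colonDeg_togliattiIdeal hn hd hP]
  exact finrank_span_singleton (pow_ne_zero _ (X_ne_zero 0))

theorem monomial_mem_inverseSystemDeg_togliattiIdeal [CharZero K] {a : Fin (n + 1) →₀ ℕ}
    (hdeg : a.degree = d) (ha : ∀ i, a i < d) (ha0 : a 0 < d - 1) :
    monomial a (1 : K) ∈ inverseSystemDeg (togliattiIdeal K n d) d := by
  rw [togliattiIdeal_eq_span_monomial, ← hdeg]
  refine monomial_mem_inverseSystemDeg ?_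
  rw [hdeg]
  rintro _ (⟨i, rfl⟩ | ⟨i, rfl⟩) hle
  · simpa using (hle i).trans_lt (ha i)
  · have h0 := hle 0
    rw [Finsupp.add_apply, Finsupp.single_eq_same] at h0
    omega

theorem exists_hasLinearInverse_togliattiIdeal [CharZero K] (hn : 2 ≤ n) {e : ℕ} (he : 2 ≤ e)
    {ι : Type*} [Finite ι]
    (F : Module.Basis ι K (inverseSystemDeg (togliattiIdeal K n (e + 1)) (e + 1))) :
    ∃ c ℓ, HasLinearInverse (fun j => (F j : MvPolynomial (Fin (n + 1)) K)) e c ℓ := by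
  obtain ⟨i, j, hi, hj, hij⟩ : ∃ i j : Fin (n + 1), i ≠ 0 ∧ j ≠ 0 ∧ i ≠ j :=
    ⟨⟨1, by omega⟩, ⟨2, by omega⟩, by simp [Fin.ext_iff]⟩
  set a : Fin (n + 1) →₀ ℕ := Finsupp.single i (e - 1) + Finsupp.single j 1 with ha
  have hdeg : a.degree = e := by
    rw [ha, map_add, Finsupp.degree_single, Finsupp.degree_single]
    omega
  refine ⟨monomial a 1, exists_hasLinearInverse F inf_le_right (isHomogeneous_monomial _ hdeg)
    (fun P hP => ?_) fun k => ?_⟩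
  · rw [eval_monomial, one_mul]
    exact Finset.prod_ne_zero_iff.2 fun k _ => pow_ne_zero _ (hP k)
  · rw [X, monomial_mul, one_mul]
    refine monomial_mem_inverseSystemDeg_togliattiIdeal ?_ (fun l => ?_) ?_
    · rw [map_add, hdeg, Finsupp.degree_single]
    · simp only [ha, Finsupp.add_apply, Finsupp.single_apply]
      split_ifs <;> omega
    · simp only [ha, Finsupp.add_apply, Finsupp.single_apply, hi, hj, if_false]
      split_ifs <;> omega

theorem satisfiesLaplaceEquations_togliattiIdeal [CharZero K] (hn : 3 ≤ n) (hd : 3 ≤ d)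
    {ι : Type*} [Fintype ι]
    (F : Module.Basis ι K (inverseSystemDeg (togliattiIdeal K n d) d)) :
    SatisfiesLaplaceEquations
      (imageVariety fun j => (F j : MvPolynomial (Fin (n + 1)) K)) n (d - 1) 1 := by
  obtain ⟨e, rfl⟩ : ∃ e, d = e + 1 := ⟨d - 1, by omega⟩
  obtain ⟨c, ℓ, h⟩ := exists_hasLinearInverse_togliattiIdeal (by omega) (by omega) F
  exact h.satisfiesLaplaceEquations (isHomogeneous_togliattiIdeal (by omega)) (by omega)
    fun P hP => finrank_colonDeg_togliattiIdeal hn (by omega) hP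

theorem sumForm_eq_linearForm (m : ℕ) : sumForm K m = linearForm 1 := by
  simp [sumForm, linearForm]

end Togliatti

end Osculating

end

theorem mainTheorem9_general (K : Type*) [Field K] [CharZero K] (n d : ℕ) (hn : 3 ≤ n)
    (hd : 3 ≤ d) :
    (∀ (ι : Type*) [Fintype ι] (F : Module.Basis ι K
        (Osculating.inverseSystemDeg (Osculating.togliattiIdeal K n d) d)),
      Osculating.SatisfiesLaplaceEquations
        (Osculating.imageVariety fun j => (F j : MvPolynomial (Fin (n + 1)) K)) n (d - 1) 1) ∧
    LinearMap.ker (Osculating.mulMap (Osculating.togliattiIdeal K n d)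
        (Osculating.sumForm_isHomogeneous K (n + 1)) (Nat.sub_add_cancel (by omega : 1 ≤ d))) =
      Submodule.span K
        {⟨Ideal.Quotient.mk (Osculating.togliattiIdeal K n d) (MvPolynomial.X 0 ^ (d - 1)),
          Osculating.mk_mem_gradedPiece _ (MvPolynomial.isHomogeneous_X_pow 0 (d - 1))⟩} ∧
    Ideal.Quotient.mk (Osculating.togliattiIdeal K n d) (MvPolynomial.X 0 ^ (d - 1)) ≠ 0 := by
  refine ⟨fun ι _ F => Osculating.satisfiesLaplaceEquations_togliattiIdeal hn hd F,
    Osculating.ker_mulMap_eq_span_singleton _ _ (MvPolynomial.isHomogeneous_X_pow 0 _) ?_,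
    ?_⟩
  · rw [Osculating.sumForm_eq_linearForm]
    exact Osculating.colonDeg_togliattiIdeal hn (by omega) (by simp)
  · rw [ne_eq, Ideal.Quotient.eq_zero_iff_mem]
    exact Osculating.X_pow_notMem_togliattiIdeal (by omega)

theorem mainTheorem9 (K : Type*) [Field K] [IsAlgClosed K] [CharZero K]
    (n d : ℕ) (hn : 4 ≤ n) (hd : 4 ≤ d) :
    (∀ (N : ℕ) (F : Module.Basis (Fin N) K
        (Osculating.inverseSystemDeg (Osculating.togliattiIdeal K n d) d)),
      Osculating.SatisfiesLaplaceEquations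
        (Osculating.imageVariety fun j => (F j : MvPolynomial (Fin (n + 1)) K)) n (d - 1) 1) ∧
    LinearMap.ker (Osculating.mulMap (Osculating.togliattiIdeal K n d)
        (Osculating.sumForm_isHomogeneous K (n + 1)) (Nat.sub_add_cancel (by omega : 1 ≤ d))) =
      Submodule.span K
        {⟨Ideal.Quotient.mk (Osculating.togliattiIdeal K n d) (MvPolynomial.X 0 ^ (d - 1)),
          Osculating.mk_mem_gradedPiece _ (MvPolynomial.isHomogeneous_X_pow 0 (d - 1))⟩} ∧
    Ideal.Quotient.mk (Osculating.togliattiIdeal K n d) (MvPolynomial.X 0 ^ (d - 1)) ≠ 0 := by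
  have h := mainTheorem9_general K n d (by omega) (by omega)
  exact ⟨fun N => h.1 (Fin N), h.2⟩
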